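/- Let $(N,h)$ be a connected oriented smooth Riemannian surface with Gaussian curvature $K^N$ and volume form $\mu^N$, let $A\in\mathbb{R}$, and let $\bar\psi,\bar\lambda,\bar\rho,\bar\nu:N\to\mathbb{R}$ be smooth functions with $\bar\psi\ge 0$ and $\bar\lambda,\bar\rho,\bar\nu>0$, satisfying $$\text{(i)}\quad K^N+\tfrac12\big(\Delta^N\ln(\bar\lambda^2\bar\nu)-|\mathrm{grad}\ln\bar\rho|^2\big)+\frac{A-\bar\psi}{\bar\lambda^2}=0,$$ $$\text{(ii)(a)}\quad \Delta^N\ln(\bar\rho^2\bar\nu\bar\psi^{-1/2})+|\mathrm{grad}\ln\bar\rho|^2-\tfrac14|\mathrm{grad}\ln\bar\psi|^2+\tfrac12h(\mathrm{grad}\ln\bar\psi,\mathrm{grad}\ln\bar\nu)+\frac{\bar\psi+A}{\bar\lambda^2}=0,$$ $$\text{(ii)(b)}\quad \bar\lambda^2\Big\{\Delta^N\ln\bar\rho-h(\mathrm{grad}\ln\bar\rho,\mathrm{grad}\ln\bar\nu)+\frac{\bar\psi+A}{\bar\lambda^2}\Big\}=\text{const.},$$ $$\text{(u)}\quad \nabla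 d\ln\bar\nu+2\,d\ln\bar\lambda\odot d\ln\bar\nu-(d\ln\bar\rho)^2=\alpha h\quad\text{for some function }\alpha:N\to\mathbb{R},$$ where $\omega\odot\eta=\frac12(\omega\otimes\eta+\eta\otimes\omega)$, $\nabla d$ is the Hessian of $h$, $\Delta^N$ is its trace, and (ii)(a) is required at the points where $\bar\psi>0$ (so it is vacuous if $\bar\psi\equiv0$). Let $\delta>0$, $M=N\times(-\delta,\delta)$, let $\phi:M\to N$ be the projection, and put $\lambda=\bar\lambda\circ\phi$, $\rho=\bar\rho\circ\phi$, $\bar\sigma=\sqrt{2\bar\psi}/\bar\lambda^2$. Let $\theta$ be a smooth $1$-form on $M$, nowhere vanishing on $\ker d\phi$, with $$d\theta+d\ln\rho\wedge\theta=\phi^*(\bar\sigma\mu^N),$$ and let $g=\phi^*h/\lambda^2+\theta^2$ (the metric of the Ricci soliton ansatz). Then $(M,g)$ has constant sectional curvature if and only if both of the following hold: (1) either $\bar\psi\equiv 0$, or $\bar\psi>0$ everywhere and $\bar\rho^2\bar\psi^{-1/2}$ is constant; (2) on $N$, $$\Big\{K^N+\Delta^N\ln(\bar\lambda\bar\rho^{-1})+|\mathrm{grad}\ln\bar\rho|^2-h(\mathrm{grad}\ln\bar\lambda,\mathrm{grad}\ln\bar\rho)-\frac{2\bar\psi}{\bar\lambda^2}\Big\}h+\nabla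 d\ln\bar\rho+2\,d\ln\bar\lambda\odot d\ln\bar\rho-(d\ln\bar\rho)^2=0.$$ -/

import Mathlib

set_option maxSynthPendingDepth 3

open scoped Manifold ContDiff

noncomputable section

/-! ### Riemannian geometry of a metric `G` on (an open part of) a finite-dimensional vector space

`G x v w` is the metric at `x` applied to `v` and `w`. The formulas below are the usual ones in linear
coordinates; they only depend on the germ of `G` at the point of evaluation. -/

namespace CoordGeom

variable {E : Type*} [NormedAddCommGroup E] [NormedSpace ℝ E]

/-- The lowered Christoffel symbols
`(v, w, z) ↦ (D_v G(w, z) + D_w G(v, z) - D_z G(v, w)) / 2`. -/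
def koszul (G : E → E →L[ℝ] E →L[ℝ] ℝ) (x : E) : E →L[ℝ] E →L[ℝ] E →L[ℝ] ℝ :=
  let D : E →L[ℝ] E →L[ℝ] E →L[ℝ] ℝ := fderiv ℝ G x
  let F : (E →L[ℝ] E →L[ℝ] ℝ) →L[ℝ] (E →L[ℝ] E →L[ℝ] ℝ) :=
    (ContinuousLinearMap.flipₗᵢ ℝ E E ℝ).toContinuousLinearEquiv.toContinuousLinearMap
  let T : E →L[ℝ] E →L[ℝ] E →L[ℝ] ℝ := F.comp D.flip
  (1 / 2 : ℝ) • (D + D.flip - T : E →L[ℝ] E →L[ℝ] E →L[ℝ] ℝ)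

theorem koszul_apply (G : E → E →L[ℝ] E →L[ℝ] ℝ) (x v w z : E) :
    koszul G x v w z
      = (1 / 2) * (fderiv ℝ G x v w z + fderiv ℝ G x w v z - fderiv ℝ G x z v w) :=
  rfl

/-- The Christoffel symbols `Γ(v, w)` of the Levi-Civita connection, so that `∇_v w = D_v w + Γ(v, w)`.
The index is raised with `(G x)⁻¹ : E* → E`. -/
def christoffel (G : E → E →L[ℝ] E →L[ℝ] ℝ) (x : E) : E →L[ℝ] E →L[ℝ] E :=
  (ContinuousLinearMap.compL ℝ E (E →L[ℝ] ℝ) E (G x).inverse).comp (koszul G x)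

/-- The curvature `R(u, v) w = ∇_u ∇_v w - ∇_v ∇_u w` for constant vector fields `u, v, w`. -/
def curvature (G : E → E →L[ℝ] E →L[ℝ] ℝ) (x u v w : E) : E :=
  fderiv ℝ (fun y => christoffel G y v w) x u - fderiv ℝ (fun y => christoffel G y u w) x v
    + christoffel G x u (christoffel G x v w) - christoffel G x v (christoffel G x u w)

/-- The Hessian `∇df (v, w) = D²f(v, w) - df(Γ(v, w))`. -/
def hessian (G : E → E →L[ℝ] E →L[ℝ] ℝ) (f : E → ℝ) (x : E) : E →L[ℝ] E →L[ℝ] ℝ :=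
  fderiv ℝ (fderiv ℝ f) x
    - (ContinuousLinearMap.compL ℝ E E ℝ (fderiv ℝ f x)).comp (christoffel G x)

/-- The Laplacian: the trace of the Hessian with respect to the metric. -/
def laplacian (G : E → E →L[ℝ] E →L[ℝ] ℝ) (f : E → ℝ) (x : E) : ℝ :=
  LinearMap.trace ℝ E ((G x).inverse.comp (hessian G f x)).toLinearMap

/-- The inner product `G(grad a, grad b) = da (G⁻¹ db)`. -/
def gradInner (G : E → E →L[ℝ] E →L[ℝ] ℝ) (a b : E → ℝ) (x : E) : ℝ :=
  fderiv ℝ a x ((G x).inverse (fderiv ℝ b x))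

end CoordGeom

/-! ### Tensor fields on a manifold, read in the preferred chart at a point -/

section Manifold

variable {E : Type*} [NormedAddCommGroup E] [NormedSpace ℝ E]
  {H : Type*} [TopologicalSpace H] (I : ModelWithCorners ℝ E H)
  {M : Type*} [TopologicalSpace M] [ChartedSpace H M]

/-- The expression of a covariant 2-tensor field in the chart at `p`. -/
def coordBilin (g : ∀ q : M, TangentSpace I q →L[ℝ] TangentSpace I q →L[ℝ] ℝ) (p : M) :
    E → E →L[ℝ] E →L[ℝ] ℝ := fun x =>
  let B : E →L[ℝ] E →L[ℝ] ℝ := g ((extChartAt I p).symm x)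
  let L : E →L[ℝ] E := mfderiv 𝓘(ℝ, E) I (extChartAt I p).symm x
  B.bilinearComp L L


/-- The expression of a 1-form in the chart at `p`. -/
def coordForm (θ : ∀ q : M, TangentSpace I q →L[ℝ] ℝ) (p : M) : E → E →L[ℝ] ℝ := fun x =>
  (θ ((extChartAt I p).symm x)).comp (mfderiv 𝓘(ℝ, E) I (extChartAt I p).symm x)

/-- The expression of a function in the chart at `p`. -/
def coordFun (f : M → ℝ) (p : M) : E → ℝ := fun x => f ((extChartAt I p).symm x)

/-- The components of a tangent vector at `p` in the chart at `p`. -/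
def coordVec (p : M) : TangentSpace I p →L[ℝ] E := mfderiv I 𝓘(ℝ, E) (extChartAt I p) p

/-- The differential of a real function. -/
def dFun (f : M → ℝ) (p : M) : TangentSpace I p →L[ℝ] ℝ := mfderiv I 𝓘(ℝ, ℝ) f p

/-- The exterior derivative of a 1-form,
`dθ(V, W) = V(θ(W)) - W(θ(V)) - θ([V, W])`, computed in the chart at `p`. -/
def extDerivOneForm (θ : ∀ q : M, TangentSpace I q →L[ℝ] ℝ) (p : M) (v w : TangentSpace I p) : ℝ :=
  fderiv ℝ (coordForm I θ p) (extChartAt I p p) (coordVec I p v) (coordVec I p w)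
    - fderiv ℝ (coordForm I θ p) (extChartAt I p p) (coordVec I p w) (coordVec I p v)

/-- The Hessian `∇df` of a function with respect to the metric `g`. -/
def hessianAt (g : ∀ q : M, TangentSpace I q →L[ℝ] TangentSpace I q →L[ℝ] ℝ) (f : M → ℝ) (p : M)
    (v w : TangentSpace I p) : ℝ :=
  CoordGeom.hessian (coordBilin I g p) (coordFun I f p) (extChartAt I p p)
    (coordVec I p v) (coordVec I p w)

/-- The Laplace-Beltrami operator (`Δf = f''` on the line). -/
def laplacianAt (g : ∀ q : M, TangentSpace I q →L[ℝ] TangentSpace I q →L[ℝ] ℝ) (f : M → ℝ)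
    (p : M) : ℝ :=
  CoordGeom.laplacian (coordBilin I g p) (coordFun I f p) (extChartAt I p p)

/-- The inner product of the gradients of two functions. -/
def gradInnerAt (g : ∀ q : M, TangentSpace I q →L[ℝ] TangentSpace I q →L[ℝ] ℝ) (a b : M → ℝ)
    (p : M) : ℝ :=
  CoordGeom.gradInner (coordBilin I g p) (coordFun I a p) (coordFun I b p) (extChartAt I p p)

/-- The value `g(R(u, v) v, u)` of the curvature tensor of `g`. -/
def curvatureFormAt (g : ∀ q : M, TangentSpace I q →L[ℝ] TangentSpace I q →L[ℝ] ℝ) (p : M)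
    (u v : TangentSpace I p) : ℝ :=
  coordBilin I g p (extChartAt I p p)
    (CoordGeom.curvature (coordBilin I g p) (extChartAt I p p)
      (coordVec I p u) (coordVec I p v) (coordVec I p v)) (coordVec I p u)

/-- The metric `g` has constant (sectional) curvature on the open set `S`: there is one constant `c`
with `g(R(u, v) v, u) = c (g(u, u) g(v, v) - g(u, v)²)` for all tangent vectors at points of `S`. -/
def HasConstantCurvatureOn (g : ∀ q : M, TangentSpace I q →L[ℝ] TangentSpace I q →L[ℝ] ℝ)
    (S : Set M) : Prop :=
  ∃ c : ℝ, ∀ q ∈ S, ∀ u v : TangentSpace I q,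
    curvatureFormAt I g q u v = c * (g q u u * g q v v - g q u v ^ 2)

/-- Smoothness of a 1-form on a set. -/
def IsSmoothOneFormOn [IsManifold I ∞ M] (θ : ∀ q : M, TangentSpace I q →L[ℝ] ℝ) (S : Set M) :
    Prop :=
  ContMDiffOn I (I.prod 𝓘(ℝ, E →L[ℝ] ℝ)) ∞
    (fun q => Bundle.TotalSpace.mk' (E →L[ℝ] ℝ)
      (E := fun q : M => TangentSpace I q →L[ℝ] Bundle.Trivial M ℝ q) q (θ q)) S

/-- The symmetric product `a ⊙ b = (a ⊗ b + b ⊗ a) / 2` of two covectors. -/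
def symProd {p : M} (a b : TangentSpace I p →L[ℝ] ℝ) (v w : TangentSpace I p) : ℝ :=
  (1 / 2) * (a v * b w + b v * a w)

/-- The wedge product `(a ∧ b)(v, w) = a(v) b(w) - a(w) b(v)` of two covectors. -/
def wedge {p : M} (a b : TangentSpace I p →L[ℝ] ℝ) (v w : TangentSpace I p) : ℝ :=
  a v * b w - a w * b v

end Manifold

/-! ### Surfaces -/

section Surface

variable {N : Type*} [TopologicalSpace N] [ChartedSpace (EuclideanSpace ℝ (Fin 2)) N]
  [IsManifold (𝓡 2) ∞ N]

/-- Smooth Riemannian metrics on a surface. -/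
abbrev SurfaceMetric (N : Type*) [TopologicalSpace N] [ChartedSpace (EuclideanSpace ℝ (Fin 2)) N]
    [IsManifold (𝓡 2) ∞ N] :=
  Bundle.ContMDiffRiemannianMetric (𝓡 2) ∞ (EuclideanSpace ℝ (Fin 2))
    (fun p : N => TangentSpace (𝓡 2) p)

/-- The Gaussian curvature `g(R(e₁, e₂) e₂, e₁) / (g(e₁, e₁) g(e₂, e₂) - g(e₁, e₂)²)`. -/
def gaussCurvature (h : SurfaceMetric N) (p : N) : ℝ :=
  let e : Fin 2 → TangentSpace (𝓡 2) p := fun i => EuclideanSpace.single i (1 : ℝ)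
  curvatureFormAt (𝓡 2) h.inner p (e 0) (e 1)
    / (h.inner p (e 0) (e 0) * h.inner p (e 1) (e 1) - h.inner p (e 0) (e 1) ^ 2)

/-- `vol` is the volume form of `h` for one of the orientations of the surface: a smooth
2-form with `vol(v, w)² = h(v, v) h(w, w) - h(v, w)²` (in particular `vol(v, v) = 0`, and
`vol(e₁, e₂) = ±1` on orthonormal bases). It exists exactly if the surface is orientable. -/
structure IsVolumeForm (h : SurfaceMetric N)
    (vol : ∀ p : N, TangentSpace (𝓡 2) p →L[ℝ] TangentSpace (𝓡 2) p →L[ℝ] ℝ) : Prop where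
  smooth : ContMDiff (𝓡 2)
    ((𝓡 2).prod 𝓘(ℝ, EuclideanSpace ℝ (Fin 2) →L[ℝ] EuclideanSpace ℝ (Fin 2) →L[ℝ] ℝ)) ∞
    (fun p => Bundle.TotalSpace.mk'
      (EuclideanSpace ℝ (Fin 2) →L[ℝ] EuclideanSpace ℝ (Fin 2) →L[ℝ] ℝ)
      (E := fun p : N => TangentSpace (𝓡 2) p →L[ℝ] TangentSpace (𝓡 2) p →L[ℝ]
        Bundle.Trivial N ℝ p) p (vol p))
  sq : ∀ (p : N) (v w : TangentSpace (𝓡 2) p),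
    vol p v w ^ 2 = h.inner p v v * h.inner p w w - h.inner p v w ^ 2

/-- The system of equations on the surface `(N, h)` for the functions `ψ ≥ 0` and `lam, ρ, ν > 0`
and the constant `A`. The equation `iia` is required where `ψ` is positive (elsewhere
`log ψ` has no meaning); so it is vacuous if `ψ` vanishes identically. -/
structure SolitonSystem (h : SurfaceMetric N) (ψ lam ρ ν : N → ℝ) (A : ℝ) : Prop where
  smooth_psi : ContMDiff (𝓡 2) 𝓘(ℝ, ℝ) ∞ ψ
  smooth_lam : ContMDiff (𝓡 2) 𝓘(ℝ, ℝ) ∞ lam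
  smooth_rho : ContMDiff (𝓡 2) 𝓘(ℝ, ℝ) ∞ ρ
  smooth_nu : ContMDiff (𝓡 2) 𝓘(ℝ, ℝ) ∞ ν
  psi_nonneg : ∀ p, 0 ≤ ψ p
  lam_pos : ∀ p, 0 < lam p
  rho_pos : ∀ p, 0 < ρ p
  nu_pos : ∀ p, 0 < ν p
  i : ∀ p,
    gaussCurvature h p
      + (1 / 2) * (laplacianAt (𝓡 2) h.inner (fun q => Real.log (lam q ^ 2 * ν q)) p
        - gradInnerAt (𝓡 2) h.inner (fun q => Real.log (ρ q)) (fun q => Real.log (ρ q)) p)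
      + (A - ψ p) / lam p ^ 2 = 0
  iia : ∀ p, 0 < ψ p →
    laplacianAt (𝓡 2) h.inner (fun q => Real.log (ρ q ^ 2 * ν q * ψ q ^ (-(1 / 2) : ℝ))) p
      + gradInnerAt (𝓡 2) h.inner (fun q => Real.log (ρ q)) (fun q => Real.log (ρ q)) p
      - (1 / 4) * gradInnerAt (𝓡 2) h.inner
          (fun q => Real.log (ψ q)) (fun q => Real.log (ψ q)) p
      + (1 / 2) * gradInnerAt (𝓡 2) h.inner
          (fun q => Real.log (ψ q)) (fun q => Real.log (ν q)) p
      + (ψ p + A) / lam p ^ 2 = 0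
  iib : ∃ c : ℝ, ∀ p,
    lam p ^ 2 * (laplacianAt (𝓡 2) h.inner (fun q => Real.log (ρ q)) p
      - gradInnerAt (𝓡 2) h.inner (fun q => Real.log (ρ q)) (fun q => Real.log (ν q)) p
      + (ψ p + A) / lam p ^ 2) = c
  u : ∃ α : N → ℝ, ∀ (p : N) (v w : TangentSpace (𝓡 2) p),
    hessianAt (𝓡 2) h.inner (fun q => Real.log (ν q)) p v w
      + 2 * symProd (𝓡 2) (dFun (𝓡 2) (fun q => Real.log (lam q)) p)
          (dFun (𝓡 2) (fun q => Real.log (ν q)) p) v w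
      - dFun (𝓡 2) (fun q => Real.log (ρ q)) p v * dFun (𝓡 2) (fun q => Real.log (ρ q)) p w
      = α p * h.inner p v w

/-! ### The 3-manifold over the surface -/

/-- The model with corners of the product `N × ℝ`. -/
abbrev I3 : ModelWithCorners ℝ (EuclideanSpace ℝ (Fin 2) × ℝ)
    (ModelProd (EuclideanSpace ℝ (Fin 2)) ℝ) := (𝓡 2).prod 𝓘(ℝ, ℝ)

/-- The 3-manifold `M = N × (-δ, δ)`, as an open subset of `N × ℝ`. -/
def slab (N : Type*) (δ : ℝ) : Set (N × ℝ) := {q | q.2 ∈ Set.Ioo (-δ) δ}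

/-- The differential of the projection `φ : N × ℝ → N`. -/
def dProj (q : N × ℝ) : TangentSpace I3 q →L[ℝ] TangentSpace (𝓡 2) q.1 :=
  mfderiv I3 (𝓡 2) (Prod.fst : N × ℝ → N) q

/-- The metric `g = φ^*h / λ² + θ²`. -/
def ansatzMetric (h : SurfaceMetric N) (lam : N → ℝ) (θ : ∀ q : N × ℝ, TangentSpace I3 q →L[ℝ] ℝ)
    (q : N × ℝ) : TangentSpace I3 q →L[ℝ] TangentSpace I3 q →L[ℝ] ℝ :=
  let B : EuclideanSpace ℝ (Fin 2) →L[ℝ] EuclideanSpace ℝ (Fin 2) →L[ℝ] ℝ := h.inner q.1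
  let P : EuclideanSpace ℝ (Fin 2) × ℝ →L[ℝ] EuclideanSpace ℝ (Fin 2) := dProj q
  let T : EuclideanSpace ℝ (Fin 2) × ℝ →L[ℝ] ℝ := θ q
  (1 / lam q.1 ^ 2) • B.bilinearComp P P + T.smulRight T

theorem ansatzMetric_apply (h : SurfaceMetric N) (lam : N → ℝ)
    (θ : ∀ q : N × ℝ, TangentSpace I3 q →L[ℝ] ℝ) (q : N × ℝ) (v w : TangentSpace I3 q) :
    ansatzMetric h lam θ q v w
      = 1 / lam q.1 ^ 2 * h.inner q.1 (dProj q v) (dProj q w) + θ q v * θ q w :=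
  rfl

/-- `θ` is a smooth 1-form on `M = N × (-δ, δ)` that vanishes nowhere on the nonzero vectors of
`ker dφ` and solves `dθ + d(log ρ) ∧ θ = φ^*(σ vol)`, where `σ = √(2ψ) / λ²`. -/
structure IsAnsatzForm (vol : ∀ p : N, TangentSpace (𝓡 2) p →L[ℝ] TangentSpace (𝓡 2) p →L[ℝ] ℝ)
    (ψ lam ρ : N → ℝ) (δ : ℝ) (θ : ∀ q : N × ℝ, TangentSpace I3 q →L[ℝ] ℝ) : Prop where
  smooth : IsSmoothOneFormOn I3 θ (slab N δ)
  ne_zero : ∀ q ∈ slab N δ, ∀ v : TangentSpace I3 q, dProj q v = 0 → v ≠ 0 → θ q v ≠ 0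
  ext : ∀ q ∈ slab N δ, ∀ v w : TangentSpace I3 q,
    extDerivOneForm I3 θ q v w
      + wedge I3 (dFun I3 (fun r : N × ℝ => Real.log (ρ r.1)) q) (θ q) v w
      = Real.sqrt (2 * ψ q.1) / lam q.1 ^ 2 * vol q.1 (dProj q v) (dProj q w)

end Surface

end

set_option maxSynthPendingDepth 3

open scoped Manifold ContDiff

noncomputable section

/-! Put `k = h/λ²`, `r = log ρ` and `s = √(2ψ)`; let `μ` be the area form of `k` and `K` its
Gaussian curvature. Then `g = k + θ²` with `dθ + dr ∧ θ = s μ`: a Riemannian submersion with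
one-dimensional fibres, whose curvature is expressed by data on the surface. For tangent vectors `u,
v` let `ξ` be the projection of `θ(v) u - θ(u) v` to `N`. A direct calculation
(`SubmersionData.apply_curvature`) gives g(R(u,v)v,u) = (K - 3/4 s²) μ(u,v)² + (∇dr - dr² + 1/4 s²
k)(ξ,ξ) - μ(u,v) (ds - 2 s dr)(ξ), while the Gram determinant of `u, v` is `μ(u,v)² + k(ξ,ξ)`. Since
`μ(u,v)` and `ξ` can be prescribed independently, curvature `c` at a point amounts to three
equations on `N` (`SubmersionData.constant_curvature_iff`): K - 3/2 ψ = c, ∇dr = dr² + (K - 2ψ) k,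
ds = 2 s dr.

On the connected surface the third equation integrates to `s = a ρ²`, and the cases `a = 0` and `a ≠
0` are the alternative in condition (1). The second equation is condition (2): insert the conformal
change formulas for the Hessian and the curvature, and use the trace of the equation to exchange the
Laplacian of `log ρ` for the other terms (`hessian_conformal_iff`).

It remains to see that (1) and (2) force `K - 3/2 ψ` to be constant. The Ricci identity applied to
the second equation gives `d(K - 2ψ) = -2ψ dr` (`fderiv_of_hessian_eq`), and `ψ = a² ρ⁴ / 2` gives
`d(ψ/2) = 2ψ dr`; the sum vanishes.

Two points need care. The root `s` has no evident derivative where `ψ = 0`; its differentiability is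
extracted from the equation for `θ` (`IsAnsatzForm.differentiableAt_sqrt`). Moreover, tensors at
each point are read in that point's own chart, so the two equations that get differentiated, for the
Hessian and for `dθ`, must first be moved into one fixed chart (`hessian_coord_eq`,
`fderiv_coordForm_eq`). -/

namespace CoordGeom

open Filter Topology

/-! ### Levi-Civita connection and curvature in linear coordinates -/

section Basic

variable {E : Type*} [NormedAddCommGroup E] [NormedSpace ℝ E]

/-- `G` is a symmetric nondegenerate bilinear form of class `C²` near `x`. -/
structure IsMetricAt (G : E → E →L[ℝ] E →L[ℝ] ℝ) (x : E) : Prop where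
  contDiffAt : ContDiffAt ℝ 2 G x
  symm : ∀ᶠ y in 𝓝 x, ∀ v w, G y v w = G y w v
  inv : (G x).IsInvertible

variable {G : E → E →L[ℝ] E →L[ℝ] ℝ} {x : E}

theorem IsMetricAt.symm_self (hG : IsMetricAt G x) (v w : E) : G x v w = G x w v :=
  hG.symm.self_of_nhds v w

theorem IsMetricAt.differentiableAt (hG : IsMetricAt G x) : DifferentiableAt ℝ G x :=
  hG.contDiffAt.differentiableAt (by norm_num)

theorem inverse_apply_apply {B : E →L[ℝ] E →L[ℝ] ℝ} (hB : B.IsInvertible) (f : E →L[ℝ] ℝ) :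
    B (B.inverse f) = f := by
  obtain ⟨e, rfl⟩ := hB
  simp

theorem inverse_apply_self {B : E →L[ℝ] E →L[ℝ] ℝ} (hB : B.IsInvertible) (v : E) :
    B.inverse (B v) = v := by
  obtain ⟨e, rfl⟩ := hB
  simp

theorem eq_of_forall_apply_eq {B : E →L[ℝ] E →L[ℝ] ℝ} (hB : B.IsInvertible) {v w : E}
    (h : ∀ z, B v z = B w z) : v = w := by
  rw [← inverse_apply_self hB v, ← inverse_apply_self hB w]
  congr 1
  ext z
  exact h z

theorem christoffel_apply (v w : E) :
    christoffel G x v w = (G x).inverse (koszul G x v w) := rfl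

theorem hessian_apply (f : E → ℝ) (v w : E) :
    hessian G f x v w = fderiv ℝ (fderiv ℝ f) x v w - fderiv ℝ f x (christoffel G x v w) := rfl

theorem apply_christoffel (hG : IsMetricAt G x) (v w z : E) :
    G x (christoffel G x v w) z = koszul G x v w z := by
  rw [christoffel_apply, inverse_apply_apply hG.inv]

theorem fderiv_apply_symm (hG : IsMetricAt G x) (u v w : E) :
    fderiv ℝ G x u v w = fderiv ℝ G x u w v := by
  have h1 : (fun y => G y v w) =ᶠ[𝓝 x] fun y => G y w v := by
    filter_upwards [hG.symm] with y hy using hy v w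
  have h2 : ∀ v w : E, fderiv ℝ (fun y => G y v w) x u = fderiv ℝ G x u v w := by
    intro v w
    have h3 := (hG.differentiableAt.hasFDerivAt.clm_apply (hasFDerivAt_const v x)).clm_apply
      (hasFDerivAt_const w x)
    rw [h3.fderiv]
    simp
  rw [← h2, ← h2, h1.fderiv_eq]

theorem koszul_symm (hG : IsMetricAt G x) (v w z : E) : koszul G x v w z = koszul G x w v z := by
  rw [koszul_apply, koszul_apply, fderiv_apply_symm hG z v w]
  ring

theorem christoffel_symm (hG : IsMetricAt G x) (v w : E) :
    christoffel G x v w = christoffel G x w v := by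
  refine eq_of_forall_apply_eq hG.inv fun z => ?_
  rw [apply_christoffel hG, apply_christoffel hG, koszul_symm hG]

theorem fderiv_apply_eq_koszul (hG : IsMetricAt G x) (u v w : E) :
    fderiv ℝ G x u v w = koszul G x u v w + koszul G x u w v := by
  rw [koszul_apply, koszul_apply, fderiv_apply_symm hG w u v, fderiv_apply_symm hG v u w,
    fderiv_apply_symm hG u w v]
  ring

theorem fderiv_apply_eq_christoffel (hG : IsMetricAt G x) (u v w : E) :
    fderiv ℝ G x u v w = G x (christoffel G x u v) w + G x v (christoffel G x u w) := by
  rw [fderiv_apply_eq_koszul hG, apply_christoffel hG, hG.symm_self v, apply_christoffel hG]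

/-- The linear map taking the derivative of a metric to its lowered Christoffel symbols. -/
def koszulMap : (E →L[ℝ] E →L[ℝ] E →L[ℝ] ℝ) →L[ℝ] (E →L[ℝ] E →L[ℝ] E →L[ℝ] ℝ) :=
  let F : (E →L[ℝ] E →L[ℝ] ℝ) →L[ℝ] (E →L[ℝ] E →L[ℝ] ℝ) :=
    (ContinuousLinearMap.flipₗᵢ ℝ E E ℝ).toContinuousLinearEquiv.toContinuousLinearMap
  let S : (E →L[ℝ] E →L[ℝ] E →L[ℝ] ℝ) →L[ℝ] (E →L[ℝ] E →L[ℝ] E →L[ℝ] ℝ) :=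
    (ContinuousLinearMap.flipₗᵢ ℝ E E (E →L[ℝ] ℝ)).toContinuousLinearEquiv.toContinuousLinearMap
  (1 / 2 : ℝ) • (ContinuousLinearMap.id ℝ _ + S - (ContinuousLinearMap.compL ℝ E _ _ F).comp S)

theorem koszul_eq_koszulMap (y : E) : koszul G y = koszulMap (fderiv ℝ G y) := rfl

theorem contDiffAt_koszul (hG : IsMetricAt G x) : ContDiffAt ℝ 1 (koszul G) x := by
  have h1 : ContDiffAt ℝ 1 (fderiv ℝ G) x := hG.contDiffAt.fderiv_right (by norm_num)
  exact (koszulMap (E := E)).contDiff.contDiffAt.comp x h1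

theorem contDiffAt_inverse [CompleteSpace E] (hG : IsMetricAt G x) :
    ContDiffAt ℝ 2 (fun y => (G y).inverse) x :=
  hG.inv.contDiffAt_map_inverse.comp x hG.contDiffAt

theorem contDiffAt_christoffel [CompleteSpace E] (hG : IsMetricAt G x) :
    ContDiffAt ℝ 1 (christoffel G) x := by
  have h1 : ContDiffAt ℝ 1 (fun y => ContinuousLinearMap.compL ℝ E (E →L[ℝ] ℝ) E (G y).inverse) x :=
    (ContinuousLinearMap.compL ℝ E (E →L[ℝ] ℝ) E).contDiff.contDiffAt.comp x
      ((contDiffAt_inverse hG).of_le (by norm_num))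
  exact h1.clm_comp (contDiffAt_koszul hG)

theorem differentiableAt_christoffel [CompleteSpace E] (hG : IsMetricAt G x) :
    DifferentiableAt ℝ (christoffel G) x :=
  (contDiffAt_christoffel hG).differentiableAt (by norm_num)

theorem fderiv_apply₂ {F : Type*} [NormedAddCommGroup F] [NormedSpace ℝ F]
    {T : E → E →L[ℝ] E →L[ℝ] F} (hT : DifferentiableAt ℝ T x) (v w u : E) :
    fderiv ℝ (fun y => T y v w) x u = fderiv ℝ T x u v w := by
  have h3 := (hT.hasFDerivAt.clm_apply (hasFDerivAt_const v x)).clm_apply (hasFDerivAt_const w x)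
  rw [h3.fderiv]
  simp

theorem fderiv_apply₁ {F : Type*} [NormedAddCommGroup F] [NormedSpace ℝ F]
    {T : E → E →L[ℝ] F} (hT : DifferentiableAt ℝ T x) (v u : E) :
    fderiv ℝ (fun y => T y v) x u = fderiv ℝ T x u v := by
  rw [(hT.hasFDerivAt.clm_apply (hasFDerivAt_const v x)).fderiv]
  simp

/-- Identities for the Christoffel symbols get differentiated, so they are needed near `x` and not
only at `x`. Invertibility persists because the invertible operators form an open set. -/
theorem IsMetricAt.eventually [CompleteSpace E] (hG : IsMetricAt G x) :
    ∀ᶠ y in 𝓝 x, IsMetricAt G y := by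
  have h1 := hG.contDiffAt.eventually (by simp)
  have h2 := hG.symm.eventually_nhds
  have h3 : ∀ᶠ y in 𝓝 x, (G y).IsInvertible := by
    obtain ⟨e, he⟩ := hG.inv
    have := hG.contDiffAt.continuousAt.eventually_mem (s := Set.range
      ((↑) : (E ≃L[ℝ] (E →L[ℝ] ℝ)) → E →L[ℝ] E →L[ℝ] ℝ)) (he ▸ ContinuousLinearEquiv.nhds e)
    filter_upwards [this] with y hy using hy
  filter_upwards [h1, h2, h3] with y a b c using ⟨a, b, c⟩

theorem curvature_apply [CompleteSpace E] (hG : IsMetricAt G x) (u v w : E) :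
    curvature G x u v w = fderiv ℝ (christoffel G) x u v w - fderiv ℝ (christoffel G) x v u w
      + christoffel G x u (christoffel G x v w) - christoffel G x v (christoffel G x u w) := by
  rw [curvature, fderiv_apply₂ (differentiableAt_christoffel hG),
    fderiv_apply₂ (differentiableAt_christoffel hG)]

/-- The curvature with the last index lowered, in terms of the lowered Christoffel symbols. -/
theorem apply_curvature [CompleteSpace E] (hG : IsMetricAt G x) (u v w z : E) :
    G x (curvature G x u v w) z
      = fderiv ℝ (fun y => koszul G y v w z) x u - fderiv ℝ (fun y => koszul G y u w z) x v
        - G x (christoffel G x u z) (christoffel G x v w)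
        + G x (christoffel G x v z) (christoffel G x u w) := by
  -- Differentiating `G(Γ(v, w), z)` trades the derivative of `Γ`, which hides that of the inverse
  -- metric, for derivatives of the lowered symbols.
  have key : ∀ u v : E, fderiv ℝ (fun y => koszul G y v w z) x u
      = fderiv ℝ G x u (christoffel G x v w) z + G x (fderiv ℝ (christoffel G) x u v w) z := by
    intro u v
    have h1 : (fun y => koszul G y v w z) =ᶠ[𝓝 x] fun y => G y (christoffel G y v w) z := by
      filter_upwards [hG.eventually] with y hy
      rw [apply_christoffel hy]
    have h2 := ((differentiableAt_christoffel hG).hasFDerivAt.clm_apply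
      (hasFDerivAt_const v x)).clm_apply (hasFDerivAt_const w x)
    have h3 := (hG.differentiableAt.hasFDerivAt.clm_apply h2).clm_apply (hasFDerivAt_const z x)
    rw [h1.fderiv_eq, h3.fderiv]
    simp [add_comm]
  have hK : ∀ a b : E, G x (christoffel G x b (christoffel G x a w)) z
      = fderiv ℝ G x b (christoffel G x a w) z
        - G x (christoffel G x b z) (christoffel G x a w) := by
    intro a b
    rw [fderiv_apply_eq_christoffel hG, hG.symm_self (christoffel G x b z)]
    ring
  rw [curvature_apply hG, key, key]
  simp only [map_add, map_sub, _root_.add_apply, _root_.sub_apply, hK]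
  ring

theorem curvature_congr {G' : E → E →L[ℝ] E →L[ℝ] ℝ} (h : G' =ᶠ[𝓝 x] G) (u v w : E) :
    curvature G' x u v w = curvature G x u v w := by
  have h1 : christoffel G' =ᶠ[𝓝 x] christoffel G := by
    filter_upwards [h.eventuallyEq_nhds] with y hy
    have hk : koszul G' y = koszul G y := by
      rw [koszul_eq_koszulMap, koszul_eq_koszulMap, hy.fderiv_eq]
    rw [christoffel, christoffel, hk, hy.self_of_nhds]
  have h2 : ∀ v w : E, (fun y => christoffel G' y v w) =ᶠ[𝓝 x] fun y => christoffel G y v w := by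
    intro v w
    filter_upwards [h1] with y hy
    rw [hy]
  rw [curvature, curvature, (h2 v w).fderiv_eq, (h2 u w).fderiv_eq, h1.self_of_nhds]

theorem curvature_swap (u v w : E) : curvature G x u v w = -curvature G x v u w := by
  rw [curvature, curvature]
  abel

theorem fderiv_fderiv_symm {F : Type*} [NormedAddCommGroup F] [NormedSpace ℝ F] {f : E → F}
    (hf : ContDiffAt ℝ 2 f x) (u v : E) :
    fderiv ℝ (fderiv ℝ f) x u v = fderiv ℝ (fderiv ℝ f) x v u :=
  hf.isSymmSndFDerivAt (by simp) u v

/-- With equal last slots the lowered symbol is half a derivative of `G`, so the derivative terms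
are second derivatives of `G` and cancel by symmetry. -/
theorem apply_curvature_self [CompleteSpace E] (hG : IsMetricAt G x) (u v w : E) :
    G x (curvature G x u v w) w = 0 := by
  have key : ∀ u v : E, fderiv ℝ (fun y => koszul G y v w w) x u
      = 1 / 2 * fderiv ℝ (fderiv ℝ G) x u v w w := by
    intro u v
    have h1 : (fun y => koszul G y v w w) =ᶠ[𝓝 x] fun y => 1 / 2 * fderiv ℝ G y v w w := by
      filter_upwards [hG.eventually] with y hy
      rw [fderiv_apply_eq_koszul hy]
      ring
    have hd : DifferentiableAt ℝ (fderiv ℝ G) x :=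
      (hG.contDiffAt.fderiv_right (m := 1) (by norm_num)).differentiableAt (by norm_num)
    have h3 := (((hd.hasFDerivAt.clm_apply (hasFDerivAt_const v x)).clm_apply
      (hasFDerivAt_const w x)).clm_apply (hasFDerivAt_const w x)).const_mul (1 / 2)
    rw [h1.fderiv_eq, h3.fderiv]
    simp
  rw [apply_curvature hG, key, key, fderiv_fderiv_symm hG.contDiffAt u v,
    hG.symm_self (christoffel G x u w)]
  ring

theorem apply_curvature_antisymm [CompleteSpace E] (hG : IsMetricAt G x) (u v w z : E) :
    G x (curvature G x u v w) z = -G x (curvature G x u v z) w := by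
  have h := apply_curvature_self hG u v (w + z)
  have hadd : curvature G x u v (w + z) = curvature G x u v w + curvature G x u v z := by
    simp only [curvature_apply hG, map_add]
    abel
  rw [hadd] at h
  simp only [map_add, _root_.add_apply, apply_curvature_self hG] at h
  linarith

end Basic

/-! ### Conformal change of a metric -/

section Conformal

variable {E : Type*} [NormedAddCommGroup E] [NormedSpace ℝ E]
  {G : E → E →L[ℝ] E →L[ℝ] ℝ} {x : E} {l : E → ℝ}

/-- The metric `exp (-2 l) G`. -/
def conformal (l : E → ℝ) (G : E → E →L[ℝ] E →L[ℝ] ℝ) (y : E) : E →L[ℝ] E →L[ℝ] ℝ :=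
  Real.exp (-2 * l y) • G y

theorem IsMetricAt.conformal (hG : IsMetricAt G x) (hl : ContDiffAt ℝ 2 l x) :
    IsMetricAt (conformal l G) x where
  contDiffAt := ((contDiffAt_const.mul hl).exp).smul hG.contDiffAt
  symm := by
    filter_upwards [hG.symm] with y hy v w
    simp [CoordGeom.conformal, hy v w]
  inv := by
    obtain ⟨e, he⟩ := hG.inv
    refine ⟨(ContinuousLinearEquiv.smulLeft (Units.mk0 _ (Real.exp_ne_zero (-2 * l x)))).trans e, ?_⟩
    ext v w
    simp [CoordGeom.conformal, ← he]

theorem koszul_conformal (hG : IsMetricAt G x) (hl : DifferentiableAt ℝ l x) (v w z : E) :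
    koszul (conformal l G) x v w z = Real.exp (-2 * l x) * (koszul G x v w z
      - fderiv ℝ l x v * G x w z - fderiv ℝ l x w * G x v z + fderiv ℝ l x z * G x v w) := by
  have h1 := ((hl.hasFDerivAt.const_mul (-2)).exp).smul hG.differentiableAt.hasFDerivAt
  have h2 : fderiv ℝ (conformal l G) x = _ := h1.fderiv
  rw [koszul_apply, h2, koszul_apply]
  simp
  ring

theorem christoffel_conformal (hG : IsMetricAt G x) (hl : ContDiffAt ℝ 2 l x) (v w : E) :
    christoffel (conformal l G) x v w = christoffel G x v w
      - fderiv ℝ l x v • w - fderiv ℝ l x w • v + G x v w • (G x).inverse (fderiv ℝ l x) := by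
  refine eq_of_forall_apply_eq (hG.conformal hl).inv fun z => ?_
  rw [apply_christoffel (hG.conformal hl), koszul_conformal hG (hl.differentiableAt (by norm_num)),
    ← apply_christoffel hG]
  simp [conformal, inverse_apply_apply hG.inv]
  ring

theorem hessian_conformal (hG : IsMetricAt G x) (hl : ContDiffAt ℝ 2 l x) (f : E → ℝ) (v w : E) :
    hessian (conformal l G) f x v w = hessian G f x v w + fderiv ℝ l x v * fderiv ℝ f x w
      + fderiv ℝ l x w * fderiv ℝ f x v - G x v w * gradInner G f l x := by
  rw [hessian_apply, hessian_apply, christoffel_conformal hG hl, gradInner]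
  simp only [map_add, map_sub, map_smul, smul_eq_mul]
  ring

theorem hasFDerivAt_koszul_apply (hG : IsMetricAt G x) (v w z : E) :
    HasFDerivAt (fun y => koszul G y v w z) (fderiv ℝ (fun y => koszul G y v w z) x) x := by
  have h1 := (contDiffAt_koszul hG).differentiableAt (by norm_num)
  exact (((h1.hasFDerivAt.clm_apply (hasFDerivAt_const v x)).clm_apply
    (hasFDerivAt_const w x)).clm_apply (hasFDerivAt_const z x)).differentiableAt.hasFDerivAt

theorem hasFDerivAt_metric_apply (hG : IsMetricAt G x) (v w : E) :
    HasFDerivAt (fun y => G y v w) (fderiv ℝ (fun y => G y v w) x) x :=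
  ((hG.differentiableAt.hasFDerivAt.clm_apply (hasFDerivAt_const v x)).clm_apply
    (hasFDerivAt_const w x)).differentiableAt.hasFDerivAt

theorem hasFDerivAt_fderiv_apply {f : E → ℝ} (hf : ContDiffAt ℝ 2 f x) (v : E) :
    HasFDerivAt (fun y => fderiv ℝ f y v) (fderiv ℝ (fun y => fderiv ℝ f y v) x) x := by
  have h1 := (hf.fderiv_right (m := 1) (by norm_num)).differentiableAt (by norm_num)
  exact (h1.hasFDerivAt.clm_apply (hasFDerivAt_const v x)).differentiableAt.hasFDerivAt

theorem fderiv_fderiv_apply {f : E → ℝ} (hf : ContDiffAt ℝ 2 f x) (v u : E) :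
    fderiv ℝ (fun y => fderiv ℝ f y v) x u = fderiv ℝ (fderiv ℝ f) x u v :=
  fderiv_apply₁ ((hf.fderiv_right (m := 1) (by norm_num)).differentiableAt (by norm_num)) v u

/-- Up to the conformal factor, the change of curvature is the Kulkarni-Nomizu product of `G` with
`C`; no dimension is assumed. Keeping `C` as a parameter leaves the long expression folded until all
derivatives have been computed. -/
theorem apply_curvature_conformal [CompleteSpace E] (hG : IsMetricAt G x) (hl : ContDiffAt ℝ 2 l x)
    {C : E → E → ℝ}
    (hC : ∀ v w, C v w = hessian G l x v w + fderiv ℝ l x v * fderiv ℝ l x w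
      - 1 / 2 * gradInner G l l x * G x v w) (u v : E) :
    conformal l G x (curvature (conformal l G) x u v v) u
      = Real.exp (-2 * l x) * (G x (curvature G x u v v) u
          + C u u * G x v v + C v v * G x u u - 2 * C u v * G x u v) := by
  have hk := hG.conformal hl
  have hl1 : ∀ᶠ y in 𝓝 x, DifferentiableAt ℝ l y :=
    (hl.eventually (by simp)).mono fun y hy => hy.differentiableAt (by norm_num)
  have hexp := ((hl.differentiableAt (by norm_num)).hasFDerivAt.const_mul (-2)).exp
  have e1 : (fun y => koszul (conformal l G) y v v u) =ᶠ[𝓝 x] fun y => Real.exp (-2 * l y) *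
      (koszul G y v v u - 2 * (fderiv ℝ l y v * G y v u) + fderiv ℝ l y u * G y v v) := by
    filter_upwards [hG.eventually, hl1] with y hy hly
    rw [koszul_conformal hy hly]
    ring
  have e2 : (fun y => koszul (conformal l G) y u v u) =ᶠ[𝓝 x] fun y => Real.exp (-2 * l y) *
      (koszul G y u v u - fderiv ℝ l y v * G y u u) := by
    filter_upwards [hG.eventually, hl1] with y hy hly
    rw [koszul_conformal hy hly, hy.symm_self v u]
    ring
  have d1 := hexp.fun_mul (((hasFDerivAt_koszul_apply hG v v u).fun_sub
    (((hasFDerivAt_fderiv_apply hl v).fun_mul (hasFDerivAt_metric_apply hG v u)).const_mul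
      2)).fun_add ((hasFDerivAt_fderiv_apply hl u).fun_mul (hasFDerivAt_metric_apply hG v v)))
  have d2 := hexp.fun_mul ((hasFDerivAt_koszul_apply hG u v u).fun_sub
    ((hasFDerivAt_fderiv_apply hl v).fun_mul (hasFDerivAt_metric_apply hG u u)))
  rw [apply_curvature hk, apply_curvature hG, e1.fderiv_eq, e2.fderiv_eq, d1.fderiv, d2.fderiv]
  simp only [hC, hessian_apply, christoffel_conformal hG hl, conformal]
  simp only [_root_.add_apply, _root_.sub_apply, _root_.smul_apply, smul_eq_mul, map_add, map_sub,
    map_smul, fderiv_fderiv_apply hl, fderiv_apply₂ hG.differentiableAt,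
    fderiv_apply_eq_christoffel hG, inverse_apply_apply hG.inv, ← apply_christoffel hG, gradInner,
    hG.symm_self _ ((G x).inverse (fderiv ℝ l x))]
  rw [hG.symm_self v u, christoffel_symm hG v u,
    hG.symm_self v (christoffel G x u u), hG.symm_self u (christoffel G x v v),
    hG.symm_self v (christoffel G x u v), hG.symm_self u (christoffel G x u v)]
  ring

end Conformal

/-! ### The Ricci identity -/

section Ricci

variable {E : Type*} [NormedAddCommGroup E] [NormedSpace ℝ E]
  {G : E → E →L[ℝ] E →L[ℝ] ℝ} {x : E}

/-- The Ricci identity for a function with Hessian `dr ⊗ dr + κ G`. -/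
theorem fderiv_curvature_of_hessian_eq [CompleteSpace E] (hG : IsMetricAt G x) {r κ : E → ℝ}
    (hr : ContDiffAt ℝ 3 r x) (hκ : DifferentiableAt ℝ κ x)
    (hess : ∀ᶠ y in 𝓝 x, ∀ v w, hessian G r y v w
      = fderiv ℝ r y v * fderiv ℝ r y w + κ y * G y v w) (u v w : E) :
    fderiv ℝ r x (curvature G x u v w)
      = κ x * (fderiv ℝ r x u * G x v w - fderiv ℝ r x v * G x u w)
        - (fderiv ℝ κ x u * G x v w - fderiv ℝ κ x v * G x u w) := by
  have hr2 : ContDiffAt ℝ 2 r x := hr.of_le (by norm_num)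
  have hdr : ContDiffAt ℝ 2 (fderiv ℝ r) x := hr.fderiv_right (by norm_num)
  have hdr1 := hdr.differentiableAt (by norm_num)
  have hddr : DifferentiableAt ℝ (fderiv ℝ (fderiv ℝ r)) x :=
    (hdr.fderiv_right (m := 1) (by norm_num)).differentiableAt (by norm_num)
  -- The Hessian equation, solved for the second derivatives of `r`, is differentiated once more.
  have key : ∀ u v : E, fderiv ℝ (fderiv ℝ (fderiv ℝ r)) x u v w
      = fderiv ℝ (fderiv ℝ r) x u (christoffel G x v w)
        + fderiv ℝ r x (fderiv ℝ (christoffel G) x u v w)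
        + (fderiv ℝ (fderiv ℝ r) x u v * fderiv ℝ r x w
          + fderiv ℝ r x v * fderiv ℝ (fderiv ℝ r) x u w)
        + (fderiv ℝ κ x u * G x v w + κ x * fderiv ℝ G x u v w) := by
    intro u v
    have h1 : (fun y => fderiv ℝ (fderiv ℝ r) y v w) =ᶠ[𝓝 x] fun y =>
        fderiv ℝ r y (christoffel G y v w) + fderiv ℝ r y v * fderiv ℝ r y w
          + κ y * G y v w := by
      filter_upwards [hess] with y hy
      have := hy v w
      rw [hessian_apply] at this
      linarith
    have h2 := ((differentiableAt_christoffel hG).hasFDerivAt.clm_apply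
      (hasFDerivAt_const v x)).clm_apply (hasFDerivAt_const w x)
    have h3 := ((hdr1.hasFDerivAt.clm_apply h2).fun_add
      ((hasFDerivAt_fderiv_apply hr2 v).fun_mul (hasFDerivAt_fderiv_apply hr2 w))).fun_add
      (hκ.hasFDerivAt.fun_mul (hasFDerivAt_metric_apply hG v w))
    rw [← fderiv_apply₂ hddr, h1.fderiv_eq, h3.fderiv]
    simp [fderiv_fderiv_apply hr2, fderiv_apply₂ hG.differentiableAt]
    ring
  have hH : ∀ a b : E, fderiv ℝ (fderiv ℝ r) x a b
      = fderiv ℝ r x (christoffel G x a b) + fderiv ℝ r x a * fderiv ℝ r x b + κ x * G x a b := by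
    intro a b
    have := hess.self_of_nhds a b
    rw [hessian_apply] at this
    linarith
  have h1 := key u v
  have h2 := key v u
  -- Third derivatives are symmetric in the first two slots, so the difference of the two instances
  -- of `key` contains `r` only through the curvature and lower order terms.
  rw [show fderiv ℝ (fderiv ℝ (fderiv ℝ r)) x v u w = fderiv ℝ (fderiv ℝ (fderiv ℝ r)) x u v w by
    rw [fderiv_fderiv_symm hdr]] at h2
  simp only [hH, fderiv_apply_eq_christoffel hG] at h1 h2
  rw [christoffel_symm hG v u, hG.symm_self v u] at h2
  rw [curvature_apply hG]
  simp only [map_add, map_sub]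
  linear_combination h2 - h1

end Ricci

/-! ### Submersions with one-dimensional fibres -/

section Submersion

theorem isInvertible_of_injective {E : Type*} [NormedAddCommGroup E] [NormedSpace ℝ E]
    [FiniteDimensional ℝ E] {B : E →L[ℝ] E →L[ℝ] ℝ} (hB : ∀ v, (∀ w, B v w = 0) → v = 0) :
    B.IsInvertible := by
  have hinj : Function.Injective B.toLinearMap := by
    rw [injective_iff_map_eq_zero]
    intro v hv
    refine hB v fun w => ?_
    have h1 : B v = 0 := hv
    rw [h1]
    rfl
  have hrank : Module.finrank ℝ E = Module.finrank ℝ (E →L[ℝ] ℝ) := by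
    rw [← (LinearMap.toContinuousLinearMap (𝕜 := ℝ) (E := E) (F' := ℝ)).finrank_eq]
    exact (Subspace.dual_finrank_eq (K := ℝ) (V := E)).symm
  refine ⟨(LinearEquiv.ofInjectiveOfFinrankEq B.toLinearMap hinj hrank).toContinuousLinearEquiv, ?_⟩
  ext v w
  rfl

variable {V : Type*} [NormedAddCommGroup V] [NormedSpace ℝ V]
  {k : V → V →L[ℝ] V →L[ℝ] ℝ} {Θ : V × ℝ → V × ℝ →L[ℝ] ℝ} {q : V × ℝ}

/-- The metric `k + Θ²` on `V × ℝ`. -/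
def submersionMetric (k : V → V →L[ℝ] V →L[ℝ] ℝ) (Θ : V × ℝ → V × ℝ →L[ℝ] ℝ) (z : V × ℝ) :
    V × ℝ →L[ℝ] V × ℝ →L[ℝ] ℝ :=
  (k z.1).bilinearComp (ContinuousLinearMap.fst ℝ V ℝ) (ContinuousLinearMap.fst ℝ V ℝ)
    + (Θ z).smulRight (Θ z)

theorem submersionMetric_apply (z v w : V × ℝ) :
    submersionMetric k Θ z v w = k z.1 v.1 w.1 + Θ z v * Θ z w := rfl

/-- Moving along the fibre direction `(0, 1)` changes the value of `θ` at will and keeps the base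
component. Together with `eq_of_fst_eq_of_apply_eq`, base component and `θ`-value serve as
coordinates on `V × ℝ`. -/
theorem exists_lift {θ : V × ℝ →L[ℝ] ℝ} (h0 : θ (0, 1) ≠ 0) (x : V) (a : ℝ) :
    ∃ w : V × ℝ, w.1 = x ∧ θ w = a := by
  refine ⟨(x, 0) + ((a - θ (x, 0)) / θ (0, 1)) • ((0, 1) : V × ℝ), by simp, ?_⟩
  rw [map_add, map_smul, smul_eq_mul, div_mul_cancel₀ _ h0]
  ring

theorem eq_of_fst_eq_of_apply_eq {θ : V × ℝ →L[ℝ] ℝ} (h0 : θ (0, 1) ≠ 0) {v w : V × ℝ}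
    (h1 : v.1 = w.1) (h2 : θ v = θ w) : v = w := by
  have h3 : v - w = (v.2 - w.2) • ((0, 1) : V × ℝ) := by
    ext <;> simp [h1]
  have h4 : θ (v - w) = 0 := by rw [map_sub, h2, sub_self]
  rw [h3, map_smul, smul_eq_mul] at h4
  rcases mul_eq_zero.1 h4 with h5 | h5
  · exact Prod.ext h1 (by linarith)
  · exact absurd h5 h0

theorem IsMetricAt.submersionMetric [FiniteDimensional ℝ V] (hk : IsMetricAt k q.1) (hΘ : ContDiffAt ℝ 2 Θ q)
    (h0 : Θ q (0, 1) ≠ 0) : IsMetricAt (submersionMetric k Θ) q where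
  contDiffAt := by
    have h1 : ContDiffAt ℝ 2 (fun z : V × ℝ => k z.1) q := hk.contDiffAt.comp q contDiffAt_fst
    have h2 : ContDiffAt ℝ 2 (fun z : V × ℝ =>
        (k z.1).bilinearComp (ContinuousLinearMap.fst ℝ V ℝ) (ContinuousLinearMap.fst ℝ V ℝ)) q := by
      have h3 : ContDiffAt ℝ 2 (fun z : V × ℝ =>
          (k z.1).comp (ContinuousLinearMap.fst ℝ V ℝ)) q := h1.clm_comp contDiffAt_const
      have h4 : ContDiffAt ℝ 2 (fun z : V × ℝ => (ContinuousLinearMap.compL ℝ (V × ℝ) V ℝ).flip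
          (ContinuousLinearMap.fst ℝ V ℝ) ∘L ((k z.1).comp (ContinuousLinearMap.fst ℝ V ℝ))) q :=
        contDiffAt_const.clm_comp h3
      exact h4
    exact h2.add (hΘ.smulRight hΘ)
  symm := by
    filter_upwards [continuousAt_fst.eventually hk.symm] with z hz v w
    rw [submersionMetric_apply, submersionMetric_apply, hz, mul_comm]
  inv := by
    refine isInvertible_of_injective fun v hv => ?_
    have h1 : Θ q v = 0 := by
      have := hv (0, 1)
      rw [submersionMetric_apply] at this
      simpa [h0] using this
    have h2 : v.1 = 0 := by
      refine eq_of_forall_apply_eq hk.inv fun z => ?_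
      have := hv (z, 0)
      rw [submersionMetric_apply, h1] at this
      simpa using this
    exact eq_of_fst_eq_of_apply_eq h0 h2 (by rw [h1, map_zero])

/-- The terms are grouped so that all brackets except the first contain only `dΘ`, which the
structural equation can replace. -/
theorem koszul_submersionMetric (hk : DifferentiableAt ℝ k q.1) (hΘ : DifferentiableAt ℝ Θ q)
    (v w z : V × ℝ) : koszul (submersionMetric k Θ) q v w z = koszul k q.1 v.1 w.1 z.1
      + 1 / 2 * (Θ q z * (fderiv ℝ Θ q v w + fderiv ℝ Θ q w v)
        + Θ q w * (fderiv ℝ Θ q v z - fderiv ℝ Θ q z v)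
        + Θ q v * (fderiv ℝ Θ q w z - fderiv ℝ Θ q z w)) := by
  have hd : DifferentiableAt ℝ (submersionMetric k Θ) q := by
    have h1 : DifferentiableAt ℝ (fun z : V × ℝ => k z.1) q := hk.comp q differentiableAt_fst
    have h4 : DifferentiableAt ℝ (fun z : V × ℝ => (ContinuousLinearMap.compL ℝ (V × ℝ) V ℝ).flip
        (ContinuousLinearMap.fst ℝ V ℝ) ∘L ((k z.1).comp (ContinuousLinearMap.fst ℝ V ℝ))) q :=
      (differentiableAt_const _).clm_comp (h1.clm_comp (differentiableAt_const _))
    exact DifferentiableAt.add h4 (((ContinuousLinearMap.smulRightL ℝ (V × ℝ)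
      (V × ℝ →L[ℝ] ℝ)).differentiableAt.comp q hΘ).clm_apply hΘ)
  have key : ∀ u v w : V × ℝ, fderiv ℝ (submersionMetric k Θ) q u v w
      = fderiv ℝ k q.1 u.1 v.1 w.1 + (fderiv ℝ Θ q u v * Θ q w + Θ q v * fderiv ℝ Θ q u w) := by
    intro u v w
    rw [← fderiv_apply₂ hd]
    have h1 : HasFDerivAt (fun z : V × ℝ => k z.1) _ q := hk.hasFDerivAt.comp q hasFDerivAt_fst
    have h2 := (h1.clm_apply (hasFDerivAt_const v.1 q)).clm_apply (hasFDerivAt_const w.1 q)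
    have h3 := (hΘ.hasFDerivAt.clm_apply (hasFDerivAt_const v q)).fun_mul
      (hΘ.hasFDerivAt.clm_apply (hasFDerivAt_const w q))
    have h4 : HasFDerivAt (fun z : V × ℝ => submersionMetric k Θ z v w) _ q := h2.fun_add h3
    rw [h4.fderiv]
    simp
    ring
  simp only [koszul_apply, key]
  ring

/-- The data of a metric `k`, an area form `μ` and functions `r, s` on the base, together with a
1-form `Θ` solving `dΘ + dr ∧ Θ = s μ`. -/
structure SubmersionData (k μ : V → V →L[ℝ] V →L[ℝ] ℝ) (r s : V → ℝ)
    (Θ : V × ℝ → V × ℝ →L[ℝ] ℝ) (q : V × ℝ) : Prop where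
  metric : IsMetricAt k q.1
  form : ContDiffAt ℝ 2 Θ q
  form_ne : Θ q (0, 1) ≠ 0
  fun_r : ContDiffAt ℝ 2 r q.1
  fun_s : DifferentiableAt ℝ s q.1
  area : DifferentiableAt ℝ μ q.1
  area_self : ∀ v, μ q.1 v v = 0
  area_parallel : ∀ u v w, fderiv ℝ μ q.1 u v w
    = μ q.1 (christoffel k q.1 u v) w + μ q.1 v (christoffel k q.1 u w)
  area_isometry : ∀ v w, μ q.1 v ((k q.1).inverse (μ q.1 w)) = k q.1 v w
  ext : ∀ᶠ z in 𝓝 q, ∀ v w, fderiv ℝ Θ z v w - fderiv ℝ Θ z w v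
    = fderiv ℝ r z.1 w.1 * Θ z v - fderiv ℝ r z.1 v.1 * Θ z w + s z.1 * μ z.1 v.1 w.1

variable {μ : V → V →L[ℝ] V →L[ℝ] ℝ} {r s : V → ℝ}

theorem SubmersionData.area_swap (D : SubmersionData k μ r s Θ q) (v w : V) :
    μ q.1 v w = -μ q.1 w v := by
  have h := D.area_self (v + w)
  simp only [map_add, _root_.add_apply, D.area_self] at h
  linarith

/-- Once `dΘ` is substituted, the Koszul formula is a pairing with a known vector. Its base part
shows the geometry: the fibres accelerate along `grad r`, and `s` acts through the rotation `k⁻¹ μ`.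
-/
theorem SubmersionData.christoffel_fst [FiniteDimensional ℝ V] (D : SubmersionData k μ r s Θ q) (v w : V × ℝ) :
    (christoffel (submersionMetric k Θ) q v w).1 = christoffel k q.1 v.1 w.1
      + (Θ q v * Θ q w) • (k q.1).inverse (fderiv ℝ r q.1)
      + (1 / 2 * s q.1) • (Θ q w • (k q.1).inverse (μ q.1 v.1)
        + Θ q v • (k q.1).inverse (μ q.1 w.1)) ∧
    Θ q (christoffel (submersionMetric k Θ) q v w)
      = 1 / 2 * (fderiv ℝ Θ q v w + fderiv ℝ Θ q w v)
        - 1 / 2 * (fderiv ℝ r q.1 v.1 * Θ q w + fderiv ℝ r q.1 w.1 * Θ q v) := by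
  -- `b` is the candidate with the desired components; pairing with every `z` identifies it.
  obtain ⟨b, hb1, hb2⟩ := exists_lift D.form_ne (christoffel k q.1 v.1 w.1
      + (Θ q v * Θ q w) • (k q.1).inverse (fderiv ℝ r q.1)
      + (1 / 2 * s q.1) • (Θ q w • (k q.1).inverse (μ q.1 v.1)
        + Θ q v • (k q.1).inverse (μ q.1 w.1)))
    (1 / 2 * (fderiv ℝ Θ q v w + fderiv ℝ Θ q w v)
        - 1 / 2 * (fderiv ℝ r q.1 v.1 * Θ q w + fderiv ℝ r q.1 w.1 * Θ q v))
  have hG := D.metric.submersionMetric D.form D.form_ne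
  have h1 : christoffel (submersionMetric k Θ) q v w = b := by
    refine eq_of_forall_apply_eq hG.inv fun z => ?_
    rw [apply_christoffel hG, koszul_submersionMetric D.metric.differentiableAt
      (D.form.differentiableAt (by norm_num)), submersionMetric_apply, hb1, hb2,
      D.ext.self_of_nhds v z, D.ext.self_of_nhds w z]
    simp only [map_add, map_smul, _root_.add_apply, _root_.smul_apply, smul_eq_mul,
      inverse_apply_apply D.metric.inv, apply_christoffel D.metric]
    ring
  rw [h1]
  exact ⟨hb1, hb2⟩

/-- One derivative of the structural equation. Since `μ` is parallel, its derivative contributes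
only Christoffel terms. -/
theorem SubmersionData.fderiv_ext (D : SubmersionData k μ r s Θ q) (u v w : V × ℝ) :
    fderiv ℝ (fderiv ℝ Θ) q u v w - fderiv ℝ (fderiv ℝ Θ) q u w v
      = fderiv ℝ (fderiv ℝ r) q.1 u.1 w.1 * Θ q v + fderiv ℝ r q.1 w.1 * fderiv ℝ Θ q u v
        - fderiv ℝ (fderiv ℝ r) q.1 u.1 v.1 * Θ q w - fderiv ℝ r q.1 v.1 * fderiv ℝ Θ q u w
        + fderiv ℝ s q.1 u.1 * μ q.1 v.1 w.1
        + s q.1 * (μ q.1 (christoffel k q.1 u.1 v.1) w.1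
          + μ q.1 v.1 (christoffel k q.1 u.1 w.1)) := by
  have h1 : (fun z => fderiv ℝ Θ z v w - fderiv ℝ Θ z w v) =ᶠ[𝓝 q] fun z =>
      fderiv ℝ r z.1 w.1 * Θ z v - fderiv ℝ r z.1 v.1 * Θ z w + s z.1 * μ z.1 v.1 w.1 := by
    filter_upwards [D.ext] with z hz using hz v w
  have hT : DifferentiableAt ℝ (fderiv ℝ Θ) q :=
    (D.form.fderiv_right (m := 1) (by norm_num)).differentiableAt (by norm_num)
  have hr : ∀ v : V, HasFDerivAt (fun z : V × ℝ => fderiv ℝ r z.1 v) _ q := fun v =>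
    (hasFDerivAt_fderiv_apply D.fun_r v).comp q hasFDerivAt_fst
  have hs : HasFDerivAt (fun z : V × ℝ => s z.1) _ q := D.fun_s.hasFDerivAt.comp q hasFDerivAt_fst
  have hm : HasFDerivAt (fun z : V × ℝ => μ z.1) _ q := D.area.hasFDerivAt.comp q hasFDerivAt_fst
  have hΘ : ∀ v : V × ℝ, HasFDerivAt (fun z : V × ℝ => Θ z v) _ q := fun v =>
    (D.form.differentiableAt (by norm_num)).hasFDerivAt.clm_apply (hasFDerivAt_const v q)
  have hT2 : ∀ v w : V × ℝ, HasFDerivAt (fun z : V × ℝ => fderiv ℝ Θ z v w) _ q := fun v w =>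
    (hT.hasFDerivAt.clm_apply (hasFDerivAt_const v q)).clm_apply (hasFDerivAt_const w q)
  have d1 := (hT2 v w).fun_sub (hT2 w v)
  have d2 := (((hr w.1).fun_mul (hΘ v)).fun_sub ((hr v.1).fun_mul (hΘ w))).fun_add (hs.fun_mul
    ((hm.clm_apply (hasFDerivAt_const v.1 q)).clm_apply (hasFDerivAt_const w.1 q)))
  have h2 := congrArg (fun T : V × ℝ →L[ℝ] ℝ => T u) (d1.fderiv.symm.trans
    (h1.fderiv_eq.trans d2.fderiv))
  simp [fderiv_fderiv_apply D.fun_r, D.area_parallel] at h2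
  linear_combination h2

/-- The curvature of a Riemannian submersion with one-dimensional fibres. -/
theorem SubmersionData.apply_curvature [FiniteDimensional ℝ V] (D : SubmersionData k μ r s Θ q) (u v : V × ℝ) {ξ : V}
    (hξ : ξ = Θ q v • u.1 - Θ q u • v.1) :
    submersionMetric k Θ q (curvature (submersionMetric k Θ) q u v v) u
      = k q.1 (curvature k q.1 u.1 v.1 v.1) u.1 - 3 / 4 * s q.1 ^ 2 * μ q.1 u.1 v.1 ^ 2
        + (hessian k r q.1 ξ ξ - fderiv ℝ r q.1 ξ ^ 2 + 1 / 4 * s q.1 ^ 2 * k q.1 ξ ξ)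
        - μ q.1 u.1 v.1 * (fderiv ℝ s q.1 ξ - 2 * s q.1 * fderiv ℝ r q.1 ξ) := by
  have hk := D.metric
  have hG := hk.submersionMetric D.form D.form_ne
  have hkd : ∀ᶠ z in 𝓝 q, DifferentiableAt ℝ k z.1 :=
    (continuousAt_fst.eventually hk.eventually).mono fun z hz => hz.differentiableAt
  have hΘd : ∀ᶠ z in 𝓝 q, DifferentiableAt ℝ Θ z :=
    (D.form.eventually (by simp)).mono fun z hz => hz.differentiableAt (by norm_num)
  have e1 : (fun z => koszul (submersionMetric k Θ) z v v u) =ᶠ[𝓝 q] fun z =>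
      koszul k z.1 v.1 v.1 u.1 + (Θ z u * fderiv ℝ Θ z v v
        + Θ z v * (fderiv ℝ Θ z v u - fderiv ℝ Θ z u v)) := by
    filter_upwards [hkd, hΘd] with z h1 h2
    rw [koszul_submersionMetric h1 h2]
    ring
  have e2 : (fun z => koszul (submersionMetric k Θ) z u v u) =ᶠ[𝓝 q] fun z =>
      koszul k z.1 u.1 v.1 u.1 + Θ z u * fderiv ℝ Θ z v u := by
    filter_upwards [hkd, hΘd] with z h1 h2
    rw [koszul_submersionMetric h1 h2]
    ring
  have hT : DifferentiableAt ℝ (fderiv ℝ Θ) q :=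
    (D.form.fderiv_right (m := 1) (by norm_num)).differentiableAt (by norm_num)
  have hK : ∀ a b c : V, HasFDerivAt (fun z : V × ℝ => koszul k z.1 a b c) _ q := fun a b c =>
    (hasFDerivAt_koszul_apply hk a b c).comp q hasFDerivAt_fst
  have hΘ : ∀ v : V × ℝ, HasFDerivAt (fun z : V × ℝ => Θ z v) _ q := fun v =>
    (D.form.differentiableAt (by norm_num)).hasFDerivAt.clm_apply (hasFDerivAt_const v q)
  have hT2 : ∀ v w : V × ℝ, HasFDerivAt (fun z : V × ℝ => fderiv ℝ Θ z v w) _ q := fun v w =>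
    (hT.hasFDerivAt.clm_apply (hasFDerivAt_const v q)).clm_apply (hasFDerivAt_const w q)
  have d1 := (hK v.1 v.1 u.1).fun_add (((hΘ u).fun_mul (hT2 v v)).fun_add
    ((hΘ v).fun_mul ((hT2 v u).fun_sub (hT2 u v))))
  have d2 := (hK u.1 v.1 u.1).fun_add ((hΘ u).fun_mul (hT2 v u))
  rw [CoordGeom.apply_curvature hG, CoordGeom.apply_curvature hk, e1.fderiv_eq, e2.fderiv_eq,
    d1.fderiv, d2.fderiv]
  -- With `hsym`, these two instances remove all second derivatives of `Θ`: they occur only in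
  -- antisymmetrised form, as derivatives of `dΘ`.
  have f1 := D.fderiv_ext v u v
  have f2 := D.fderiv_ext u v u
  have f3 := D.ext.self_of_nhds v u
  have hsym : fderiv ℝ (fderiv ℝ Θ) q u v v = fderiv ℝ (fderiv ℝ Θ) q v u v := by
    rw [fderiv_fderiv_symm D.form]
  have m1 := D.area_swap v.1 u.1
  have m4 := D.area_swap (christoffel k q.1 u.1 v.1) u.1
  have m5 := D.area_swap (christoffel k q.1 u.1 v.1) v.1
  have c1 := christoffel_symm hk v.1 u.1
  have r1 := fderiv_fderiv_symm D.fun_r v.1 u.1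
  -- The next three rules move the gradient of `r` and the rotation `k⁻¹ μ` across `k`, so that both
  -- sides become polynomials in the same scalars.
  have hgJ : ∀ w, fderiv ℝ r q.1 ((k q.1).inverse (μ q.1 w))
      = μ q.1 w ((k q.1).inverse (fderiv ℝ r q.1)) := by
    intro w
    have h := hk.symm_self ((k q.1).inverse (fderiv ℝ r q.1)) ((k q.1).inverse (μ q.1 w))
    rwa [inverse_apply_apply hk.inv, inverse_apply_apply hk.inv] at h
  have hkr : ∀ w, k q.1 w ((k q.1).inverse (fderiv ℝ r q.1)) = fderiv ℝ r q.1 w := by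
    intro w
    rw [hk.symm_self, inverse_apply_apply hk.inv]
  have hkJ : ∀ v w, k q.1 w ((k q.1).inverse (μ q.1 v)) = μ q.1 v w := by
    intro v w
    rw [hk.symm_self, inverse_apply_apply hk.inv]
  have f3' := eq_add_of_sub_eq f3
  subst hξ
  simp only [submersionMetric_apply, (D.christoffel_fst _ _).1, (D.christoffel_fst _ _).2,
    hessian_apply]
  simp only [_root_.add_apply, _root_.sub_apply, _root_.smul_apply, smul_eq_mul, map_add, map_sub,
    map_smul, ContinuousLinearMap.comp_apply, ContinuousLinearMap.coe_fst',
    ContinuousLinearMap.flip_apply, _root_.zero_apply, map_zero, zero_add,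
    inverse_apply_apply hk.inv, hkr, hkJ, hgJ, D.area_isometry, c1, r1] at f1 f2 ⊢
  simp only [m1, m4, m5, f3', hk.symm_self v.1 u.1] at f1 f2 ⊢
  linear_combination Θ q u * f1 + Θ q v * f2 + Θ q u * hsym

end Submersion

/-! ### Bilinear algebra and area forms in dimension two -/

section Plane

/-- The Euclidean plane. -/
abbrev Plane := EuclideanSpace ℝ (Fin 2)

/-- The standard basis vectors of the plane. -/
abbrev stdVec (i : Fin 2) : Plane := EuclideanSpace.single i (1 : ℝ)

/-- The determinant of two plane vectors. -/
def det2 (u v : Plane) : ℝ := u 0 * v 1 - u 1 * v 0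

theorem plane_eq (u : Plane) : u = u 0 • stdVec 0 + u 1 • stdVec 1 := by
  ext i
  fin_cases i <;> simp

/-- The Gram determinant of a bilinear form in the standard basis. -/
def gram (B : Plane →L[ℝ] Plane →L[ℝ] ℝ) : ℝ := B (stdVec 0) (stdVec 0) * B (stdVec 1) (stdVec 1) - B (stdVec 0) (stdVec 1) ^ 2

theorem linear_expand {F : Type*} [AddCommGroup F] [Module ℝ F] [TopologicalSpace F]
    (f : Plane →L[ℝ] F) (u : Plane) : f u = u 0 • f (stdVec 0) + u 1 • f (stdVec 1) := by
  conv_lhs => rw [plane_eq u]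
  simp only [map_add, map_smul]

theorem bilin_expand (B : Plane →L[ℝ] Plane →L[ℝ] ℝ) (u v : Plane) :
    B u v = u 0 * v 0 * B (stdVec 0) (stdVec 0) + u 0 * v 1 * B (stdVec 0) (stdVec 1)
      + u 1 * v 0 * B (stdVec 1) (stdVec 0) + u 1 * v 1 * B (stdVec 1) (stdVec 1) := by
  rw [linear_expand B u, _root_.add_apply, _root_.smul_apply, _root_.smul_apply,
    linear_expand (B (stdVec 0)) v, linear_expand (B (stdVec 1)) v]
  simp only [smul_eq_mul]
  ring

theorem cauchy_binet {B : Plane →L[ℝ] Plane →L[ℝ] ℝ} (hB : ∀ v w, B v w = B w v) (a b c d : Plane) :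
    B a c * B b d - B a d * B b c = det2 a b * det2 c d * gram B := by
  rw [bilin_expand B a c, bilin_expand B b d, bilin_expand B a d, bilin_expand B b c,
    hB (stdVec 1) (stdVec 0), det2, det2, gram]
  ring

theorem gram_eq {B : Plane →L[ℝ] Plane →L[ℝ] ℝ} (hB : ∀ v w, B v w = B w v) (a b : Plane) :
    B a a * B b b - B a b ^ 2 = det2 a b ^ 2 * gram B := by
  have h := cauchy_binet hB a b a b
  rw [hB b a] at h
  linear_combination h

/-- Gram-Schmidt without division: the vector `B₀₀ e₁ - B₀₁ e₀` is orthogonal to `e₀` and has square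
length `B₀₀` times the Gram determinant. -/
theorem gram_pos {B : Plane →L[ℝ] Plane →L[ℝ] ℝ} (hB : ∀ v w, B v w = B w v)
    (hp : ∀ v, v ≠ 0 → 0 < B v v) : 0 < gram B := by
  have h0 : 0 < B (stdVec 0) (stdVec 0) := hp _ (by simp)
  have h1 : 0 < B (B (stdVec 0) (stdVec 0) • stdVec 1 - B (stdVec 0) (stdVec 1) • stdVec 0)
      (B (stdVec 0) (stdVec 0) • stdVec 1 - B (stdVec 0) (stdVec 1) • stdVec 0) := by
    refine hp _ fun h => ?_
    have h2 := congrArg (fun v : Plane => v 1) h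
    simp at h2
    simp [h2] at h0
  have h2 : B (B (stdVec 0) (stdVec 0) • stdVec 1 - B (stdVec 0) (stdVec 1) • stdVec 0)
      (B (stdVec 0) (stdVec 0) • stdVec 1 - B (stdVec 0) (stdVec 1) • stdVec 0) = B (stdVec 0) (stdVec 0) * gram B := by
    simp only [map_sub, map_smul, _root_.sub_apply, _root_.smul_apply, smul_eq_mul, gram,
      hB (stdVec 1) (stdVec 0)]
    ring
  rw [h2] at h1
  exact pos_of_mul_pos_right h1 h0.le

theorem alternating_expand {η : Plane →L[ℝ] Plane →L[ℝ] ℝ} (hη : ∀ v, η v v = 0) (v w : Plane) :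
    η v w = det2 v w * η (stdVec 0) (stdVec 1) := by
  have h := hη (stdVec 0 + stdVec 1)
  simp only [map_add, _root_.add_apply, hη] at h
  rw [bilin_expand η v w, hη, hη, det2]
  linear_combination v 1 * w 0 * h

theorem area_self_eq_zero {B η : Plane →L[ℝ] Plane →L[ℝ] ℝ}
    (h : ∀ v w, η v w ^ 2 = B v v * B w w - B v w ^ 2) (v : Plane) : η v v = 0 := by
  have := h v v
  rw [← sq, sub_self] at this
  exact pow_eq_zero_iff (two_ne_zero) |>.1 this

/-- Both sides are the same product of two determinants times a constant, and the hypothesis on the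
standard basis compares the constants. -/
theorem area_mul_area {B η : Plane →L[ℝ] Plane →L[ℝ] ℝ} (hB : ∀ v w, B v w = B w v)
    (h : ∀ v w, η v w ^ 2 = B v v * B w w - B v w ^ 2) (a b c d : Plane) :
    η a b * η c d = B a c * B b d - B a d * B b c := by
  rw [cauchy_binet hB, alternating_expand (area_self_eq_zero h) a b,
    alternating_expand (area_self_eq_zero h) c d, gram, ← h]
  ring

theorem area_ne_zero {B η : Plane →L[ℝ] Plane →L[ℝ] ℝ} (hB : ∀ v w, B v w = B w v)
    (hp : ∀ v, v ≠ 0 → 0 < B v v) (h : ∀ v w, η v w ^ 2 = B v v * B w w - B v w ^ 2) :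
    η (stdVec 0) (stdVec 1) ≠ 0 := by
  intro h0
  have := h (stdVec 0) (stdVec 1)
  rw [h0] at this
  have hg := gram_pos hB hp
  rw [gram] at hg
  linarith

theorem isInvertible_of_pos {E : Type*} [NormedAddCommGroup E] [NormedSpace ℝ E]
    [FiniteDimensional ℝ E] {B : E →L[ℝ] E →L[ℝ] ℝ} (hp : ∀ v, v ≠ 0 → 0 < B v v) :
    B.IsInvertible :=
  isInvertible_of_injective fun v hv => by
    by_contra hne
    exact (hp v hne).ne' (hv v)

/-- The operator `B⁻¹ η` is the rotation by a right angle, hence an isometry. After multiplication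
by `η w z` the claim follows from `area_mul_area`, and for `w ≠ 0` some such factor is nonzero. -/
theorem area_isometry {B η : Plane →L[ℝ] Plane →L[ℝ] ℝ} (hB : ∀ v w, B v w = B w v)
    (hp : ∀ v, v ≠ 0 → 0 < B v v) (h : ∀ v w, η v w ^ 2 = B v v * B w w - B v w ^ 2) (v w : Plane) :
    η v (B.inverse (η w)) = B v w := by
  have hinv := isInvertible_of_pos hp
  have hJ : ∀ z, B (B.inverse (η w)) z = η w z := fun z => by rw [inverse_apply_apply hinv]
  have key : ∀ z, η v (B.inverse (η w)) * η w z = B v w * η w z := by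
    intro z
    rw [area_mul_area hB h, hJ, hJ, area_self_eq_zero h]
    ring
  by_cases hw : w = 0
  · simp [hw]
  have hne : ∃ z, η w z ≠ 0 := by
    by_contra! hz
    refine hw ?_
    have h0 := hz (stdVec 0)
    have h1 := hz (stdVec 1)
    rw [alternating_expand (area_self_eq_zero h)] at h0 h1
    have hn := area_ne_zero hB hp h
    have h0' := (mul_eq_zero.1 h0).resolve_right hn
    have h1' := (mul_eq_zero.1 h1).resolve_right hn
    simp [det2] at h0' h1'
    rw [plane_eq w, h0', h1']
    simp
  obtain ⟨z, hz⟩ := hne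
  exact mul_right_cancel₀ hz (key z)

variable {G : Plane → Plane →L[ℝ] Plane →L[ℝ] ℝ} {x : Plane}

/-- The covariant derivative of `μ` along `u` is again alternating, hence a single number in
dimension two. Differentiating the square of `μ` on the standard basis as a Gram determinant shows
that `μ` times this number is zero. -/
theorem area_parallel (hG : IsMetricAt G x) (hp : ∀ v, v ≠ 0 → 0 < G x v v)
    {μ : Plane → Plane →L[ℝ] Plane →L[ℝ] ℝ} (hμ : DifferentiableAt ℝ μ x)
    (h : ∀ᶠ y in 𝓝 x, ∀ v w, μ y v w ^ 2 = G y v v * G y w w - G y v w ^ 2) (u v w : Plane) :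
    fderiv ℝ μ x u v w = μ x (christoffel G x u v) w + μ x v (christoffel G x u w) := by
  have h0 := h.self_of_nhds
  have hs := hG.symm_self
  let η : Plane →L[ℝ] Plane →L[ℝ] ℝ := fderiv ℝ μ x u
    - ((μ x).bilinearComp (christoffel G x u) (ContinuousLinearMap.id ℝ _)
      + (μ x).bilinearComp (ContinuousLinearMap.id ℝ _) (christoffel G x u))
  have hη : ∀ v w, η v w = fderiv ℝ μ x u v w
      - (μ x (christoffel G x u v) w + μ x v (christoffel G x u w)) := fun _ _ => rfl
  have hself : ∀ v, η v v = 0 := by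
    intro v
    have h1 : (fun y => μ y v v) =ᶠ[𝓝 x] fun _ => 0 := by
      filter_upwards [h] with y hy using area_self_eq_zero hy v
    have h2 : fderiv ℝ μ x u v v = 0 := by
      rw [← fderiv_apply₂ hμ, h1.fderiv_eq]
      simp
    have h3 := area_self_eq_zero h0 (christoffel G x u v + v)
    simp only [map_add, _root_.add_apply, area_self_eq_zero h0] at h3
    rw [hη, h2]
    linarith
  have h01 : η (stdVec 0) (stdVec 1) = 0 := by
    have hm := (hμ.hasFDerivAt.clm_apply (hasFDerivAt_const (stdVec 0) x)).clm_apply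
      (hasFDerivAt_const (stdVec 1) x)
    have e1 : (fun y => μ y (stdVec 0) (stdVec 1) * μ y (stdVec 0) (stdVec 1)) =ᶠ[𝓝 x] fun y =>
        G y (stdVec 0) (stdVec 0) * G y (stdVec 1) (stdVec 1) - G y (stdVec 0) (stdVec 1) * G y (stdVec 0) (stdVec 1) := by
      filter_upwards [h] with y hy
      rw [← sq, ← sq, hy]
    have d1 := hm.fun_mul hm
    have d2 := ((hasFDerivAt_metric_apply hG (stdVec 0) (stdVec 0)).fun_mul
      (hasFDerivAt_metric_apply hG (stdVec 1) (stdVec 1))).fun_sub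
      ((hasFDerivAt_metric_apply hG (stdVec 0) (stdVec 1)).fun_mul
      (hasFDerivAt_metric_apply hG (stdVec 0) (stdVec 1)))
    have h2 := congrArg (fun T : Plane →L[ℝ] ℝ => T u) (d1.fderiv.symm.trans
      (e1.fderiv_eq.trans d2.fderiv))
    simp only [_root_.add_apply, _root_.sub_apply, _root_.smul_apply, smul_eq_mul,
      fderiv_apply₂ hG.differentiableAt, fderiv_apply_eq_christoffel hG,
      ContinuousLinearMap.comp_apply, ContinuousLinearMap.flip_apply, _root_.zero_apply,
      map_zero, zero_add] at h2
    have a1 := area_mul_area hs h0 (christoffel G x u (stdVec 0)) (stdVec 1) (stdVec 0) (stdVec 1)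
    rw [hs (stdVec 1) (stdVec 0)] at a1
    have a2 := area_mul_area hs h0 (stdVec 0) (christoffel G x u (stdVec 1)) (stdVec 0) (stdVec 1)
    have hn := area_ne_zero hs hp h0
    refine mul_left_cancel₀ hn ?_
    rw [hη, mul_zero]
    rw [hs (stdVec 0) (christoffel G x u (stdVec 0)), hs (stdVec 1) (christoffel G x u (stdVec 1)),
      hs (stdVec 0) (christoffel G x u (stdVec 1))] at h2
    linear_combination 1 / 2 * h2 - a1 - a2
  have := alternating_expand hself v w
  rw [h01, mul_zero, hη] at this
  linarith

/-- Antisymmetry in the first pair and in the last pair of slots each contributes one factor `det2 u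
v`. -/
theorem apply_curvature_plane (hG : IsMetricAt G x) (u v : Plane) :
    G x (curvature G x u v v) u = det2 u v ^ 2 * G x (curvature G x (stdVec 0) (stdVec 1) (stdVec 1)) (stdVec 0) := by
  have h1 : ∀ u w : Plane, curvature G x u u w = 0 := by
    intro u w
    rw [curvature_apply hG]
    abel
  have h2 : ∀ w, curvature G x u v w = det2 u v • curvature G x (stdVec 0) (stdVec 1) w := by
    intro w
    have h3 : curvature G x u v w = (u 0 * v 0) • curvature G x (stdVec 0) (stdVec 0) w
      + (u 0 * v 1) • curvature G x (stdVec 0) (stdVec 1) w + (u 1 * v 0) • curvature G x (stdVec 1) (stdVec 0) w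
      + (u 1 * v 1) • curvature G x (stdVec 1) (stdVec 1) w := by
      simp only [curvature_apply hG]
      rw [plane_eq u, plane_eq v]
      simp only [map_add, map_smul, _root_.add_apply, _root_.smul_apply]
      simp
      module
    rw [h3, h1, h1, curvature_swap (stdVec 1) (stdVec 0), det2]
    module
  have h4 : curvature G x (stdVec 0) (stdVec 1) v
      = v 0 • curvature G x (stdVec 0) (stdVec 1) (stdVec 0) + v 1 • curvature G x (stdVec 0) (stdVec 1) (stdVec 1) := by
    simp only [curvature_apply hG]
    conv_lhs => rw [plane_eq v]
    simp only [map_add, map_smul]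
    module
  rw [h2, h4, linear_expand (G x _) u]
  simp only [map_add, map_smul, _root_.add_apply, _root_.smul_apply, smul_eq_mul,
    apply_curvature_self hG, apply_curvature_antisymm hG (stdVec 0) (stdVec 1) (stdVec 0) (stdVec 1)]
  rw [det2]
  ring

/-- Multiplication by the Gram determinant clears the inverse metric, so identities for Laplacians
and gradients become polynomial in components. -/
theorem trace_plane {B : Plane →L[ℝ] Plane →L[ℝ] ℝ} (hB : ∀ v w, B v w = B w v) (hinv : B.IsInvertible)
    (T : Plane →L[ℝ] Plane →L[ℝ] ℝ) : LinearMap.trace ℝ Plane (B.inverse.comp T).toLinearMap * gram B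
      = T (stdVec 0) (stdVec 0) * B (stdVec 1) (stdVec 1) + T (stdVec 1) (stdVec 1) * B (stdVec 0) (stdVec 0)
        - (T (stdVec 0) (stdVec 1) + T (stdVec 1) (stdVec 0)) * B (stdVec 0) (stdVec 1) := by
  have h1 : ∀ i j, T (stdVec i) (stdVec j) = (B.inverse (T (stdVec i))) 0 * B (stdVec 0) (stdVec j)
      + (B.inverse (T (stdVec i))) 1 * B (stdVec 1) (stdVec j) := by
    intro i j
    have h2 : T (stdVec i) (stdVec j) = B (B.inverse (T (stdVec i))) (stdVec j) := by rw [inverse_apply_apply hinv]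
    rw [h2, linear_expand B]
    simp
  rw [LinearMap.trace_eq_matrix_trace ℝ (EuclideanSpace.basisFun (Fin 2) ℝ).toBasis,
    Matrix.trace_fin_two]
  simp only [LinearMap.toMatrix_apply]
  simp only [OrthonormalBasis.coe_toBasis, EuclideanSpace.basisFun_apply,
    OrthonormalBasis.coe_toBasis_repr_apply, EuclideanSpace.basisFun_repr,
    ContinuousLinearMap.coe_coe, ContinuousLinearMap.comp_apply]
  rw [h1 0 0, h1 1 1, h1 0 1, h1 1 0, hB (stdVec 1) (stdVec 0), gram]
  ring

theorem laplacian_plane (hG : IsMetricAt G x) (f : Plane → ℝ) :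
    laplacian G f x * gram (G x) = hessian G f x (stdVec 0) (stdVec 0) * G x (stdVec 1) (stdVec 1)
      + hessian G f x (stdVec 1) (stdVec 1) * G x (stdVec 0) (stdVec 0)
      - (hessian G f x (stdVec 0) (stdVec 1) + hessian G f x (stdVec 1) (stdVec 0)) * G x (stdVec 0) (stdVec 1) :=
  trace_plane hG.symm_self hG.inv _

theorem gradInner_plane (hG : IsMetricAt G x) (a b : Plane → ℝ) :
    gradInner G a b x * gram (G x) = fderiv ℝ a x (stdVec 0) * fderiv ℝ b x (stdVec 0) * G x (stdVec 1) (stdVec 1)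
      + fderiv ℝ a x (stdVec 1) * fderiv ℝ b x (stdVec 1) * G x (stdVec 0) (stdVec 0)
      - (fderiv ℝ a x (stdVec 0) * fderiv ℝ b x (stdVec 1) + fderiv ℝ a x (stdVec 1) * fderiv ℝ b x (stdVec 0))
        * G x (stdVec 0) (stdVec 1) := by
  have h1 : ∀ j, fderiv ℝ b x (stdVec j) = ((G x).inverse (fderiv ℝ b x)) 0 * G x (stdVec 0) (stdVec j)
      + ((G x).inverse (fderiv ℝ b x)) 1 * G x (stdVec 1) (stdVec j) := by
    intro j
    have h2 : fderiv ℝ b x (stdVec j) = G x ((G x).inverse (fderiv ℝ b x)) (stdVec j) := by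
      rw [inverse_apply_apply hG.inv]
    conv_lhs => rw [h2, linear_expand (G x)]
    simp
  rw [gradInner, linear_expand (fderiv ℝ a x), h1 0, h1 1, hG.symm_self (stdVec 1) (stdVec 0), gram]
  simp only [smul_eq_mul]
  ring

end Plane

/-! ### Curvature and Hessian equations on a surface -/

section PlaneMetrics

variable {G : Plane → Plane →L[ℝ] Plane →L[ℝ] ℝ} {x : Plane} {l r : Plane → ℝ}

theorem hessian_symm {E : Type*} [NormedAddCommGroup E] [NormedSpace ℝ E]
    {G : E → E →L[ℝ] E →L[ℝ] ℝ} {x : E} (hG : IsMetricAt G x) {f : E → ℝ}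
    (hf : ContDiffAt ℝ 2 f x) (v w : E) : hessian G f x v w = hessian G f x w v := by
  rw [hessian_apply, hessian_apply, fderiv_fderiv_symm hf, christoffel_symm hG]

/-- The Gaussian curvature of a metric on the plane. -/
def gauss (G : Plane → Plane →L[ℝ] Plane →L[ℝ] ℝ) (x : Plane) : ℝ :=
  G x (curvature G x (stdVec 0) (stdVec 1) (stdVec 1)) (stdVec 0) / gram (G x)

theorem apply_curvature_eq_gauss (hG : IsMetricAt G x) (hp : ∀ v, v ≠ 0 → 0 < G x v v)
    (u v : Plane) : G x (curvature G x u v v) u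
      = gauss G x * (G x u u * G x v v - G x u v ^ 2) := by
  have hg := (gram_pos hG.symm_self hp).ne'
  rw [apply_curvature_plane hG, gram_eq hG.symm_self, gauss]
  field_simp

theorem conformal_apply (v w : Plane) :
    conformal l G x v w = Real.exp (-2 * l x) * G x v w := rfl

theorem conformal_pos (hp : ∀ v, v ≠ 0 → 0 < G x v v) (v : Plane) (hv : v ≠ 0) :
    0 < conformal l G x v v := mul_pos (Real.exp_pos _) (hp v hv)

/-- In dimension two only the trace of the tensor `C` matters. Its gradient terms cancel there,
`|dl|² - 1/2 · 2 |dl|² = 0`, and the Laplacian of `l` remains. -/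
theorem apply_curvature_conformal_plane (hG : IsMetricAt G x) (hp : ∀ v, v ≠ 0 → 0 < G x v v)
    (hl : ContDiffAt ℝ 2 l x) (u v : Plane) :
    conformal l G x (curvature (conformal l G) x u v v) u
      = Real.exp (2 * l x) * (gauss G x + laplacian G l x) * (conformal l G x u u *
        conformal l G x v v - conformal l G x u v ^ 2) := by
  have hg := (gram_pos hG.symm_self hp).ne'
  have hk := hG.conformal hl
  have hexp : Real.exp (2 * l x) * Real.exp (-2 * l x) = 1 := by
    rw [← Real.exp_add]
    simp
  have h1 := apply_curvature_conformal hG hl (C := fun v w => hessian G l x v w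
    + fderiv ℝ l x v * fderiv ℝ l x w - 1 / 2 * gradInner G l l x * G x v w)
    (fun _ _ => rfl) (stdVec 0) (stdVec 1)
  rw [apply_curvature_eq_gauss hG hp] at h1
  have h2 := laplacian_plane hG l
  have h3 := gradInner_plane hG l l
  have h4 := hessian_symm hG hl (stdVec 1) (stdVec 0)
  rw [apply_curvature_plane hk, gram_eq hk.symm_self, h1, gram]
  simp only [conformal_apply]
  rw [gram] at h2 h3
  rw [h4] at h2
  linear_combination (-det2 u v ^ 2 * Real.exp (-2 * l x)) * (h2 + h3)
    - (gauss G x + laplacian G l x) * det2 u v ^ 2 * (G x (stdVec 0) (stdVec 0)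
      * G x (stdVec 1) (stdVec 1) - G x (stdVec 0) (stdVec 1) ^ 2) * Real.exp (-2 * l x) * hexp

theorem hessian_sub (hl : ContDiffAt ℝ 2 l x) (hr : ContDiffAt ℝ 2 r x) (v w : Plane) :
    hessian G (fun y => l y - r y) x v w = hessian G l x v w - hessian G r x v w := by
  have h1 : fderiv ℝ (fun y => l y - r y) =ᶠ[𝓝 x] fun y => fderiv ℝ l y - fderiv ℝ r y := by
    filter_upwards [hl.eventually (by simp), hr.eventually (by simp)] with y h1 h2
    exact fderiv_fun_sub (h1.differentiableAt (by norm_num)) (h2.differentiableAt (by norm_num))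
  have h2 := (hl.fderiv_right (m := 1) (by norm_num)).differentiableAt (by norm_num)
  have h3 := (hr.fderiv_right (m := 1) (by norm_num)).differentiableAt (by norm_num)
  rw [hessian_apply, hessian_apply, hessian_apply, h1.fderiv_eq, fderiv_fun_sub h2 h3,
    h1.self_of_nhds]
  simp only [_root_.sub_apply]
  ring

/-- After the conformal formula is inserted, the two equations differ by `(2 (S + Δl) - Δr + |dr|²)
G`. Each of them forces this factor to vanish: it is `key`, obtained by taking the trace. -/
theorem hessian_conformal_iff (hG : IsMetricAt G x) (hp : ∀ v, v ≠ 0 → 0 < G x v v)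
    (hl : ContDiffAt ℝ 2 l x) (hr : ContDiffAt ℝ 2 r x) (S : ℝ) :
    (∀ v w, (S + laplacian G (fun y => l y - r y) x + gradInner G r r x - gradInner G l r x)
        * G x v w + hessian G r x v w
        + 2 * (1 / 2 * (fderiv ℝ l x v * fderiv ℝ r x w + fderiv ℝ l x w * fderiv ℝ r x v))
        - fderiv ℝ r x v * fderiv ℝ r x w = 0) ↔
      ∀ v w, hessian (conformal l G) r x v w = fderiv ℝ r x v * fderiv ℝ r x w
        + Real.exp (2 * l x) * (S + laplacian G l x) * conformal l G x v w := by
  have hg := (gram_pos hG.symm_self hp).ne'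
  have hexp : Real.exp (2 * l x) * Real.exp (-2 * l x) = 1 := by
    rw [← Real.exp_add]
    simp
  have hlap : laplacian G (fun y => l y - r y) x = laplacian G l x - laplacian G r x := by
    refine mul_right_cancel₀ hg ?_
    rw [sub_mul, laplacian_plane hG, laplacian_plane hG, laplacian_plane hG]
    simp only [hessian_sub hl hr]
    ring
  have hcomm : gradInner G r l x = gradInner G l r x := by
    refine mul_right_cancel₀ hg ?_
    rw [gradInner_plane hG, gradInner_plane hG]
    ring
  have h1 := laplacian_plane hG r
  have h2 := gradInner_plane hG r r
  have h3 := gradInner_plane hG l r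
  simp only [hessian_conformal hG hl, hlap, conformal_apply, hcomm]
  constructor
  · intro h v w
    have key : 2 * (S + laplacian G l x - laplacian G r x + gradInner G r r x - gradInner G l r x)
        + laplacian G r x + 2 * gradInner G l r x - gradInner G r r x = 0 := by
      refine mul_right_cancel₀ hg ?_
      have t00 := h (stdVec 0) (stdVec 0)
      have t01 := h (stdVec 0) (stdVec 1)
      have t10 := h (stdVec 1) (stdVec 0)
      have t11 := h (stdVec 1) (stdVec 1)
      rw [hG.symm_self (stdVec 1) (stdVec 0)] at t10
      rw [gram] at *
      linear_combination G x (stdVec 1) (stdVec 1) * t00 + G x (stdVec 0) (stdVec 0) * t11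
        - G x (stdVec 0) (stdVec 1) * (t01 + t10) + h1 + 2 * h3 - h2
    linear_combination h v w - G x v w * key - (S + laplacian G l x) * G x v w * hexp
  · intro h v w
    have key : laplacian G r x - gradInner G r r x - 2 * (S + laplacian G l x) = 0 := by
      refine mul_right_cancel₀ hg ?_
      have t00 := h (stdVec 0) (stdVec 0)
      have t01 := h (stdVec 0) (stdVec 1)
      have t10 := h (stdVec 1) (stdVec 0)
      have t11 := h (stdVec 1) (stdVec 1)
      rw [hG.symm_self (stdVec 1) (stdVec 0)] at t10
      rw [gram] at *
      linear_combination G x (stdVec 1) (stdVec 1) * t00 + G x (stdVec 0) (stdVec 0) * t11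
        - G x (stdVec 0) (stdVec 1) * (t01 + t10) + h1 + 2 * h3 - h2
        + 2 * (S + laplacian G l x) * (G x (stdVec 0) (stdVec 0)
      * G x (stdVec 1) (stdVec 1) - G x (stdVec 0) (stdVec 1) ^ 2) * hexp
    linear_combination h v w - G x v w * key + (S + laplacian G l x) * G x v w * hexp

theorem exists_orthogonal (hp : ∀ v, v ≠ 0 → 0 < G x v v) (u : Plane) (hu : u ≠ 0) :
    ∃ v, v ≠ 0 ∧ G x u v = 0 := by
  refine ⟨G x u (stdVec 1) • stdVec 0 - G x u (stdVec 0) • stdVec 1, fun h => ?_, ?_⟩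
  · have h0 := congrArg (fun v : Plane => v 0) h
    have h1 := congrArg (fun v : Plane => v 1) h
    simp at h0 h1
    have h2 := hp u hu
    rw [linear_expand (G x u) u] at h2
    simp [h0, h1] at h2
  · simp only [map_sub, map_smul, smul_eq_mul]
    ring

theorem eq_zero_of_orthogonal (hs : ∀ v w, G x v w = G x w v) (hp : ∀ v, v ≠ 0 → 0 < G x v v)
    {u v z : Plane} (hu : u ≠ 0) (hv : v ≠ 0) (huv : G x u v = 0) (hzu : G x z u = 0)
    (hzv : G x z v = 0) : z = 0 := by
  by_contra hz
  have hg := gram_pos hs hp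
  have h1 := gram_eq hs u v
  have h5 := gram_eq hs u z
  have h6 := cauchy_binet hs u v u z
  have hpu := hp u hu
  rw [huv] at h1
  rw [hs u z, hzu] at h5
  rw [hs v z, hzv, hs u z, hzu] at h6
  have hd : det2 u v ≠ 0 := by
    intro h
    rw [h] at h1
    linarith [mul_pos hpu (hp v hv)]
  have hd' : det2 u z ≠ 0 := by
    intro h
    rw [h] at h5
    linarith [mul_pos hpu (hp z hz)]
  exact mul_ne_zero (mul_ne_zero hd hd') hg.ne' (by linarith)

/-- For `v` orthogonal to `u` the curvature hypothesis means `R(u, v) v = K |v|² u`, and the Ricci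
identity for `r` becomes `dκ(u) = (κ - K) dr(u)`. -/
theorem fderiv_of_hessian_eq (hG : IsMetricAt G x) (hp : ∀ v, v ≠ 0 → 0 < G x v v)
    (hr : ContDiffAt ℝ 3 r x) {κ : Plane → ℝ} {K : ℝ}
    (hess : ∀ᶠ y in 𝓝 x, ∀ v w, hessian G r y v w
      = fderiv ℝ r y v * fderiv ℝ r y w + κ y * G y v w)
    (hK : ∀ u v, G x (curvature G x u v v) u = K * (G x u u * G x v v - G x u v ^ 2)) :
    HasFDerivAt κ (-(K - κ x) • fderiv ℝ r x) x := by
  have hr2 : ContDiffAt ℝ 2 r x := hr.of_le (by norm_num)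
  have hdr : ContDiffAt ℝ 2 (fderiv ℝ r) x := hr.fderiv_right (by norm_num)
  have hddr : DifferentiableAt ℝ (fderiv ℝ (fderiv ℝ r)) x :=
    (hdr.fderiv_right (m := 1) (by norm_num)).differentiableAt (by norm_num)
  have h0 : G x (stdVec 0) (stdVec 0) ≠ 0 := (hp _ (by simp)).ne'
  have hm := hasFDerivAt_metric_apply hG (stdVec 0) (stdVec 0)
  -- `κ` is recovered from the Hessian equation on one fixed vector; three derivatives of `r` make
  -- this quotient differentiable.
  have hκ : DifferentiableAt ℝ κ x := by
    have h1 : DifferentiableAt ℝ (fun y => fderiv ℝ (fderiv ℝ r) y (stdVec 0) (stdVec 0)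
        - fderiv ℝ r y (christoffel G y (stdVec 0) (stdVec 0))
        - fderiv ℝ r y (stdVec 0) * fderiv ℝ r y (stdVec 0)) x := by
      have hd := (hasFDerivAt_fderiv_apply hr2 (stdVec 0)).differentiableAt
      exact (((hddr.clm_apply (differentiableAt_const _)).clm_apply (differentiableAt_const _)).sub
        ((hdr.differentiableAt (by norm_num)).clm_apply (((differentiableAt_christoffel hG).clm_apply
          (differentiableAt_const _)).clm_apply (differentiableAt_const _)))).sub (hd.mul hd)
    have h4 := h1.fun_mul (hm.differentiableAt.fun_inv h0)
    refine h4.congr_of_eventuallyEq ?_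
    filter_upwards [hess, hm.continuousAt.eventually_ne h0] with y hy hne
    have := hy (stdVec 0) (stdVec 0)
    rw [hessian_apply] at this
    rw [← div_eq_mul_inv, eq_div_iff hne]
    linarith
  have key : ∀ u, fderiv ℝ κ x u = -(K - κ x) * fderiv ℝ r x u := by
    intro u
    by_cases hu : u = 0
    · simp [hu]
    obtain ⟨v, hv, huv⟩ := exists_orthogonal hp u hu
    have hR : curvature G x u v v - (K * G x v v) • u = 0 := by
      refine eq_zero_of_orthogonal hG.symm_self hp hu hv huv ?_ ?_
      · simp [hK, huv]
        ring
      · simp [apply_curvature_self hG, huv]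
    have h2 := fderiv_curvature_of_hessian_eq hG hr hκ hess u v v
    rw [sub_eq_zero.1 hR, map_smul, smul_eq_mul, huv] at h2
    refine mul_right_cancel₀ (hp v hv).ne' ?_
    linear_combination h2
  have h3 : fderiv ℝ κ x = -(K - κ x) • fderiv ℝ r x := by
    ext u
    rw [key]
    rfl
  rw [← h3]
  exact hκ.hasFDerivAt

variable {k μ : Plane → Plane →L[ℝ] Plane →L[ℝ] ℝ} {s : Plane → ℝ}
  {Θ : Plane × ℝ → Plane × ℝ →L[ℝ] ℝ} {q : Plane × ℝ}

/-- Both sides are quadratic in the number `μ(u, v)` and the vector `ξ`. These vary freely, so the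
coefficients can be compared. -/
theorem SubmersionData.constant_curvature_iff (D : SubmersionData k μ r s Θ q)
    (hp : ∀ v, v ≠ 0 → 0 < k q.1 v v)
    (hμ : ∀ v w, μ q.1 v w ^ 2 = k q.1 v v * k q.1 w w - k q.1 v w ^ 2) {K : ℝ}
    (hK : ∀ u v, k q.1 (curvature k q.1 u v v) u
      = K * (k q.1 u u * k q.1 v v - k q.1 u v ^ 2)) (c : ℝ) :
    (∀ u v, submersionMetric k Θ q (curvature (submersionMetric k Θ) q u v v) u
        = c * (submersionMetric k Θ q u u * submersionMetric k Θ q v v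
          - submersionMetric k Θ q u v ^ 2)) ↔
      K - 3 / 4 * s q.1 ^ 2 = c ∧
      (∀ v w, hessian k r q.1 v w = fderiv ℝ r q.1 v * fderiv ℝ r q.1 w
        + (c - 1 / 4 * s q.1 ^ 2) * k q.1 v w) ∧
      ∀ u, fderiv ℝ s q.1 u = 2 * s q.1 * fderiv ℝ r q.1 u := by
  have hs := D.metric.symm_self
  have hdet : ∀ u v, submersionMetric k Θ q u u * submersionMetric k Θ q v v
      - submersionMetric k Θ q u v ^ 2 = μ q.1 u.1 v.1 ^ 2
        + k q.1 (Θ q v • u.1 - Θ q u • v.1) (Θ q v • u.1 - Θ q u • v.1) := by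
    intro u v
    simp only [submersionMetric_apply, hμ, map_sub, map_smul, _root_.sub_apply, _root_.smul_apply,
      smul_eq_mul, hs v.1 u.1]
    ring
  have hn : μ q.1 (stdVec 0) (stdVec 1) ≠ 0 := area_ne_zero hs hp hμ
  constructor
  · intro h
    -- By `exists_lift` the base parts `y, z` and the vertical parts `a, b` of the two vectors are
    -- arbitrary.
    have H : ∀ (y z : Plane) (a b : ℝ), K * μ q.1 y z ^ 2 - 3 / 4 * s q.1 ^ 2 * μ q.1 y z ^ 2
        + (hessian k r q.1 (b • y - a • z) (b • y - a • z) - fderiv ℝ r q.1 (b • y - a • z) ^ 2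
          + 1 / 4 * s q.1 ^ 2 * k q.1 (b • y - a • z) (b • y - a • z))
        - μ q.1 y z * (fderiv ℝ s q.1 (b • y - a • z)
          - 2 * s q.1 * fderiv ℝ r q.1 (b • y - a • z))
        = c * (μ q.1 y z ^ 2 + k q.1 (b • y - a • z) (b • y - a • z)) := by
      intro y z a b
      obtain ⟨u, rfl, rfl⟩ := exists_lift D.form_ne y a
      obtain ⟨v, rfl, rfl⟩ := exists_lift D.form_ne z b
      have h1 := h u v
      rw [hdet, D.apply_curvature u v rfl, hK, ← hμ] at h1
      exact h1
    have h1 : K - 3 / 4 * s q.1 ^ 2 = c := by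
      -- A horizontal pair: `ξ = 0`.
      have h2 := H (stdVec 0) (stdVec 1) 0 0
      simp at h2
      refine mul_right_cancel₀ (pow_ne_zero 2 hn) ?_
      linear_combination h2
    have hQ : ∀ v, hessian k r q.1 v v = fderiv ℝ r q.1 v * fderiv ℝ r q.1 v
        + (c - 1 / 4 * s q.1 ^ 2) * k q.1 v v := by
      intro v
      -- A vertical second vector: `ξ = v` and the area is zero. Polarisation then gives the
      -- bilinear equation.
      have h2 := H v 0 0 1
      simp at h2
      linear_combination h2
    refine ⟨h1, fun v w => ?_, fun u => ?_⟩
    · have h2 := hQ (v + w)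
      simp only [map_add, _root_.add_apply, hQ v, hQ w, hs w v,
        hessian_symm D.metric D.fun_r w v] at h2
      linear_combination 1 / 2 * h2
    · have h2 := H (stdVec 0) (stdVec 1) (-u 1) (u 0)
      rw [neg_smul, sub_neg_eq_add, ← plane_eq, hQ] at h2
      refine mul_left_cancel₀ hn ?_
      linear_combination -h2 + μ q.1 (stdVec 0) (stdVec 1) ^ 2 * h1
  · rintro ⟨h1, h2, h3⟩ u v
    rw [hdet, D.apply_curvature u v rfl, hK, ← hμ, h2, h3]
    linear_combination μ q.1 u.1 v.1 ^ 2 * h1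

end PlaneMetrics

/-! ### Naturality under changes of coordinates -/

section Pullback

variable {E : Type*} [NormedAddCommGroup E] [NormedSpace ℝ E] {x : E} {τ : E → E}

/-- The second derivative of `τ` enters symmetrically and cancels in the difference. -/
theorem fderiv_pullback_form {Θ Θ' : E → E →L[ℝ] ℝ} (hΘ : DifferentiableAt ℝ Θ (τ x))
    (hτ : ContDiffAt ℝ 2 τ x) (h : ∀ᶠ y in 𝓝 x, ∀ v, Θ' y v = Θ (τ y) (fderiv ℝ τ y v))
    (v w : E) : fderiv ℝ Θ' x v w - fderiv ℝ Θ' x w v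
      = fderiv ℝ Θ (τ x) (fderiv ℝ τ x v) (fderiv ℝ τ x w)
        - fderiv ℝ Θ (τ x) (fderiv ℝ τ x w) (fderiv ℝ τ x v) := by
  have hτ1 := (hτ.differentiableAt (by norm_num)).hasFDerivAt
  have hτ2 := ((hτ.fderiv_right (m := 1) (by norm_num)).differentiableAt (by norm_num)).hasFDerivAt
  have h0 : Θ' =ᶠ[𝓝 x] fun y => (Θ (τ y)).comp (fderiv ℝ τ y) := by
    filter_upwards [h] with y hy
    ext v
    exact hy v
  have hc : HasFDerivAt (fun y => Θ (τ y)) _ x := hΘ.hasFDerivAt.comp x hτ1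
  have h1 := hc.clm_comp hτ2
  have key : ∀ v w : E, fderiv ℝ Θ' x v w = fderiv ℝ Θ (τ x) (fderiv ℝ τ x v) (fderiv ℝ τ x w)
      + Θ (τ x) (fderiv ℝ (fderiv ℝ τ) x v w) := by
    intro v w
    rw [h0.fderiv_eq, h1.fderiv]
    simp [add_comm]
  rw [key, key, fderiv_fderiv_symm hτ v w]
  ring

/-- The second derivative of `τ` in the transformation law `hΓ` of the Christoffel symbols cancels
the one produced by the second derivative of `f ∘ τ`. -/
theorem hessian_pullback {G G' : E → E →L[ℝ] E →L[ℝ] ℝ} {f f' : E → ℝ}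
    (hG : IsMetricAt G (τ x)) (hG' : IsMetricAt G' x) (hτ : ContDiffAt ℝ 2 τ x)
    (hinv : (fderiv ℝ τ x).IsInvertible) (hf : ContDiffAt ℝ 2 f (τ x))
    (h : ∀ᶠ y in 𝓝 x, ∀ v w, G' y v w = G (τ y) (fderiv ℝ τ y v) (fderiv ℝ τ y w))
    (hff : f' =ᶠ[𝓝 x] fun y => f (τ y)) (v w : E) :
    hessian G' f' x v w = hessian G f (τ x) (fderiv ℝ τ x v) (fderiv ℝ τ x w) := by
  have hτ1 := (hτ.differentiableAt (by norm_num)).hasFDerivAt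
  have hτ2 := ((hτ.fderiv_right (m := 1) (by norm_num)).differentiableAt (by norm_num)).hasFDerivAt
  have hD : ∀ u v w : E, fderiv ℝ G' x u v w
      = fderiv ℝ G (τ x) (fderiv ℝ τ x u) (fderiv ℝ τ x v) (fderiv ℝ τ x w)
        + G (τ x) (fderiv ℝ (fderiv ℝ τ) x u v) (fderiv ℝ τ x w)
        + G (τ x) (fderiv ℝ τ x v) (fderiv ℝ (fderiv ℝ τ) x u w) := by
    intro u v w
    have h1 : (fun y => G' y v w) =ᶠ[𝓝 x]
        fun y => G (τ y) (fderiv ℝ τ y v) (fderiv ℝ τ y w) := by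
      filter_upwards [h] with y hy using hy v w
    have h2 : HasFDerivAt (fun y => G (τ y)) _ x := hG.differentiableAt.hasFDerivAt.comp x hτ1
    have h3 := (h2.clm_apply (hτ2.clm_apply (hasFDerivAt_const v x))).clm_apply
      (hτ2.clm_apply (hasFDerivAt_const w x))
    rw [← fderiv_apply₂ hG'.differentiableAt, h1.fderiv_eq, h3.fderiv]
    simp
    ring
  have hK : ∀ v w z : E, koszul G' x v w z
      = koszul G (τ x) (fderiv ℝ τ x v) (fderiv ℝ τ x w) (fderiv ℝ τ x z)
        + G (τ x) (fderiv ℝ (fderiv ℝ τ) x v w) (fderiv ℝ τ x z) := by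
    intro v w z
    rw [koszul_apply, koszul_apply, hD, hD, hD, fderiv_fderiv_symm hτ w v,
      fderiv_fderiv_symm hτ z v, fderiv_fderiv_symm hτ z w,
      hG.symm_self (fderiv ℝ τ x w) (fderiv ℝ (fderiv ℝ τ) x v z)]
    ring
  have hΓ : fderiv ℝ τ x (christoffel G' x v w)
      = christoffel G (τ x) (fderiv ℝ τ x v) (fderiv ℝ τ x w) + fderiv ℝ (fderiv ℝ τ) x v w := by
    refine eq_of_forall_apply_eq hG.inv fun z => ?_
    obtain ⟨z, rfl⟩ : ∃ z', fderiv ℝ τ x z' = z := by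
      obtain ⟨e, he⟩ := hinv
      exact ⟨e.symm z, by rw [← he]; simp⟩
    rw [← h.self_of_nhds, apply_christoffel hG', hK, map_add, _root_.add_apply,
      apply_christoffel hG]
  have hf1 : ∀ᶠ y in 𝓝 x, fderiv ℝ f' y = (fderiv ℝ f (τ y)).comp (fderiv ℝ τ y) := by
    have e1 := hτ.continuousAt.eventually (hf.eventually (by simp))
    filter_upwards [hff.eventuallyEq_nhds, e1, hτ.eventually (by simp)] with y h1 h2 h3
    rw [h1.fderiv_eq]
    exact ((h2.differentiableAt (by norm_num)).hasFDerivAt.comp y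
      (h3.differentiableAt (by norm_num)).hasFDerivAt).fderiv
  have hf2 := ((hf.fderiv_right (m := 1) (by norm_num)).differentiableAt (by norm_num)).hasFDerivAt
  have hc : HasFDerivAt (fun y => fderiv ℝ f (τ y)) _ x := hf2.comp x hτ1
  have h4 := hc.clm_comp hτ2
  have h5 : fderiv ℝ (fderiv ℝ f') x v w
      = fderiv ℝ (fderiv ℝ f) (τ x) (fderiv ℝ τ x v) (fderiv ℝ τ x w)
        + fderiv ℝ f (τ x) (fderiv ℝ (fderiv ℝ τ) x v w) := by
    rw [EventuallyEq.fderiv_eq hf1, h4.fderiv]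
    simp [add_comm]
  rw [hessian_apply, hessian_apply, h5, hf1.self_of_nhds, ContinuousLinearMap.comp_apply, hΓ,
    map_add]
  ring

end Pullback

end CoordGeom

/-! ### Charts and their transition maps -/

section Charts

open Filter Topology CoordGeom

variable {E : Type*} [NormedAddCommGroup E] [NormedSpace ℝ E]
  {H : Type*} [TopologicalSpace H] {I : ModelWithCorners ℝ E H}
  {M : Type*} [TopologicalSpace M] [ChartedSpace H M]

/-- The derivative of the inverse of the chart at `p`, as a linear map of the model space. -/
def symmDeriv (I : ModelWithCorners ℝ E H) (p : M) (x : E) : E →L[ℝ] E :=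
  mfderiv 𝓘(ℝ, E) I (extChartAt I p).symm x

/-- The transition map from the chart at `p` to the chart at `q`. -/
def chartChange (I : ModelWithCorners ℝ E H) (p q : M) (x : E) : E :=
  extChartAt I q ((extChartAt I p).symm x)

theorem mfderivWithin_range_eq [I.Boundaryless] (p : M) (x : E) :
    mfderivWithin 𝓘(ℝ, E) I (extChartAt I p).symm (Set.range I) x
      = mfderiv 𝓘(ℝ, E) I (extChartAt I p).symm x := by
  rw [I.range_eq_univ, mfderivWithin_univ]

/-- The tangent space at `p` is the model space read through the preferred chart at `p`, so the
derivative of that chart at its own centre is the identity. -/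
theorem coordVec_eq [IsManifold I ∞ M] (p : M) : coordVec I p = ContinuousLinearMap.id ℝ E := by
  have : IsManifold I 1 M := IsManifold.of_le (n := ∞) (by simp)
  exact mfderiv_extChartAt_self

theorem symmDeriv_self [I.Boundaryless] [IsManifold I ∞ M]
    (p : M) : symmDeriv I p (extChartAt I p p) = ContinuousLinearMap.id ℝ E := by
  have : IsManifold I 1 M := IsManifold.of_le (n := ∞) (by simp)
  rw [symmDeriv, ← mfderivWithin_range_eq]
  exact mfderivWithin_range_extChartAt_symm

theorem symmDeriv_isInvertible [I.Boundaryless] [IsManifold I ∞ M]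
    (p : M) {x : E} (hx : x ∈ (extChartAt I p).target) :
    (symmDeriv I p x).IsInvertible := by
  have : IsManifold I 1 M := IsManifold.of_le (n := ∞) (by simp)
  rw [symmDeriv, ← mfderivWithin_range_eq]
  exact isInvertible_mfderivWithin_extChartAt_symm hx

theorem mdifferentiableAt_extChartAt_symm' [I.Boundaryless] [IsManifold I ∞ M]
    (p : M) {x : E} (hx : x ∈ (extChartAt I p).target) :
    MDifferentiableAt 𝓘(ℝ, E) I (extChartAt I p).symm x := by
  have : IsManifold I 1 M := IsManifold.of_le (n := ∞) (by simp)
  have := mdifferentiableWithinAt_extChartAt_symm hx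
  rwa [I.range_eq_univ, mdifferentiableWithinAt_univ] at this

theorem contDiffAt_chartChange [I.Boundaryless] [IsManifold I ∞ M]
    (p q : M) {x : E} (hx : x ∈ (extChartAt I p).target)
    (hq : (extChartAt I p).symm x ∈ (extChartAt I q).source) :
    ContDiffAt ℝ ∞ (chartChange I p q) x := by
  have := contDiffWithinAt_ext_coord_change (I := I) (n := ∞) q p (y := x)
    (by
      rw [PartialEquiv.trans_source, PartialEquiv.symm_source]
      exact ⟨hx, hq⟩)
  rwa [I.range_eq_univ, contDiffWithinAt_univ] at this

theorem eventually_symm_mem_source (p q : M) {x : E} (hx : x ∈ (extChartAt I p).target)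
    (hq : (extChartAt I p).symm x ∈ (extChartAt I q).source) :
    ∀ᶠ y in 𝓝 x, (extChartAt I p).symm y ∈ (extChartAt I q).source :=
  (continuousAt_extChartAt_symm'' hx).eventually ((isOpen_extChartAt_source q).mem_nhds hq)

theorem symmDeriv_eq [I.Boundaryless] [IsManifold I ∞ M]
    (p q : M) {x : E} (hx : x ∈ (extChartAt I p).target)
    (hq : (extChartAt I p).symm x ∈ (extChartAt I q).source) :
    symmDeriv I p x = (symmDeriv I q (chartChange I p q x)).comp
      (fderiv ℝ (chartChange I p q) x) := by
  have h1 : (extChartAt I p).symm =ᶠ[𝓝 x]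
      (extChartAt I q).symm ∘ chartChange I p q := by
    filter_upwards [eventually_symm_mem_source p q hx hq] with y hy
    exact ((extChartAt I q).left_inv hy).symm
  have h2 : chartChange I p q x ∈ (extChartAt I q).target := (extChartAt I q).map_source hq
  have h3 := (contDiffAt_chartChange p q hx hq).differentiableAt (by simp)
  rw [symmDeriv, h1.mfderiv_eq, mfderiv_comp x (mdifferentiableAt_extChartAt_symm' q h2)
    h3.mdifferentiableAt, mfderiv_eq_fderiv]
  rfl

theorem fderiv_chartChange [I.Boundaryless] [IsManifold I ∞ M]
    (p q : M) (hq : q ∈ (extChartAt I p).source) :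
    fderiv ℝ (chartChange I p q) (extChartAt I p q) = symmDeriv I p (extChartAt I p q) := by
  have hx := (extChartAt I p).map_source hq
  have hl := (extChartAt I p).left_inv hq
  have h := symmDeriv_eq p q hx (by rw [hl]; exact mem_extChartAt_source q)
  rw [h, chartChange, hl, symmDeriv_self]
  rfl

end Charts

/-! ### Tensor fields in charts: transformation and smoothness -/

section TensorsInCharts

open Filter Topology CoordGeom

variable {E : Type*} [NormedAddCommGroup E] [NormedSpace ℝ E]
  {H : Type*} [TopologicalSpace H] {I : ModelWithCorners ℝ E H}
  {M : Type*} [TopologicalSpace M] [ChartedSpace H M]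

theorem coordBilin_self [I.Boundaryless] [IsManifold I ∞ M]
    (g : ∀ q : M, TangentSpace I q →L[ℝ] TangentSpace I q →L[ℝ] ℝ) (p : M)
    (v w : E) : coordBilin I g p (extChartAt I p p) v w
      = (g p : E →L[ℝ] E →L[ℝ] ℝ) v w := by
  let B : M → E →L[ℝ] E →L[ℝ] ℝ := g
  change B ((extChartAt I p).symm (extChartAt I p p)) (symmDeriv I p (extChartAt I p p) v)
    (symmDeriv I p (extChartAt I p p) w) = B p v w
  rw [symmDeriv_self, extChartAt_to_inv]
  rfl

theorem coordBilin_eq (g : ∀ q : M, TangentSpace I q →L[ℝ] TangentSpace I q →L[ℝ] ℝ) (p q : M)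
    (hq : q ∈ (extChartAt I p).source) (v w : E) :
    coordBilin I g p (extChartAt I p q) v w = (g q : E →L[ℝ] E →L[ℝ] ℝ)
      (symmDeriv I p (extChartAt I p q) v) (symmDeriv I p (extChartAt I p q) w) := by
  let B : M → E →L[ℝ] E →L[ℝ] ℝ := g
  change B ((extChartAt I p).symm (extChartAt I p q)) (symmDeriv I p (extChartAt I p q) v)
    (symmDeriv I p (extChartAt I p q) w) = B q _ _
  rw [(extChartAt I p).left_inv hq]

theorem coordForm_self [I.Boundaryless] [IsManifold I ∞ M]
    (θ : ∀ q : M, TangentSpace I q →L[ℝ] ℝ) (p : M) (v : E) :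
    coordForm I θ p (extChartAt I p p) v = (θ p : E →L[ℝ] ℝ) v := by
  let B : M → E →L[ℝ] ℝ := θ
  change B ((extChartAt I p).symm (extChartAt I p p)) (symmDeriv I p (extChartAt I p p) v) = B p v
  rw [symmDeriv_self, extChartAt_to_inv]
  rfl

theorem coordForm_eq (θ : ∀ q : M, TangentSpace I q →L[ℝ] ℝ) (p q : M)
    (hq : q ∈ (extChartAt I p).source) (v : E) :
    coordForm I θ p (extChartAt I p q) v
      = (θ q : E →L[ℝ] ℝ) (symmDeriv I p (extChartAt I p q) v) := by
  let B : M → E →L[ℝ] ℝ := θ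
  change B ((extChartAt I p).symm (extChartAt I p q)) (symmDeriv I p (extChartAt I p q) v) = B q _
  rw [(extChartAt I p).left_inv hq]

theorem coordFun_eq (f : M → ℝ) (p q : M) (hq : q ∈ (extChartAt I p).source) :
    coordFun I f p (extChartAt I p q) = f q := by
  rw [coordFun, (extChartAt I p).left_inv hq]

theorem coordBilin_change [I.Boundaryless] [IsManifold I ∞ M]
    (g : ∀ q : M, TangentSpace I q →L[ℝ] TangentSpace I q →L[ℝ] ℝ) (p q : M)
    (hq : q ∈ (extChartAt I p).source) : ∀ᶠ y in 𝓝 (extChartAt I p q), ∀ v w,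
      coordBilin I g p y v w = coordBilin I g q (chartChange I p q y)
        (fderiv ℝ (chartChange I p q) y v) (fderiv ℝ (chartChange I p q) y w) := by
  have hx := (extChartAt I p).map_source hq
  have hl := (extChartAt I p).left_inv hq
  let B : M → E →L[ℝ] E →L[ℝ] ℝ := g
  filter_upwards [extChartAt_target_mem_nhds' hx, eventually_symm_mem_source p q hx
    (by rw [hl]; exact mem_extChartAt_source q)] with y hy1 hy2 v w
  change B ((extChartAt I p).symm y) (symmDeriv I p y v) (symmDeriv I p y w)
    = B ((extChartAt I q).symm (chartChange I p q y)) (symmDeriv I q (chartChange I p q y) _)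
      (symmDeriv I q (chartChange I p q y) _)
  rw [symmDeriv_eq p q hy1 hy2, chartChange, (extChartAt I q).left_inv hy2]
  rfl

theorem coordForm_change [I.Boundaryless] [IsManifold I ∞ M]
    (θ : ∀ q : M, TangentSpace I q →L[ℝ] ℝ) (p q : M)
    (hq : q ∈ (extChartAt I p).source) : ∀ᶠ y in 𝓝 (extChartAt I p q), ∀ v,
      coordForm I θ p y v = coordForm I θ q (chartChange I p q y)
        (fderiv ℝ (chartChange I p q) y v) := by
  have hx := (extChartAt I p).map_source hq
  have hl := (extChartAt I p).left_inv hq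
  let B : M → E →L[ℝ] ℝ := θ
  filter_upwards [extChartAt_target_mem_nhds' hx, eventually_symm_mem_source p q hx
    (by rw [hl]; exact mem_extChartAt_source q)] with y hy1 hy2 v
  change B ((extChartAt I p).symm y) (symmDeriv I p y v)
    = B ((extChartAt I q).symm (chartChange I p q y)) (symmDeriv I q (chartChange I p q y) _)
  rw [symmDeriv_eq p q hy1 hy2, chartChange, (extChartAt I q).left_inv hy2]
  rfl

theorem coordFun_change (f : M → ℝ) (p q : M) (hq : q ∈ (extChartAt I p).source) :
    coordFun I f p =ᶠ[𝓝 (extChartAt I p q)] fun y => coordFun I f q (chartChange I p q y) := by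
  have hx := (extChartAt I p).map_source hq
  have hl := (extChartAt I p).left_inv hq
  filter_upwards [eventually_symm_mem_source p q hx
    (by rw [hl]; exact mem_extChartAt_source q)] with y hy2
  rw [coordFun, coordFun, chartChange, (extChartAt I q).left_inv hy2]

theorem contDiffAt_coordFun [I.Boundaryless] [IsManifold I ∞ M]
    {f : M → ℝ} (p q : M) (hq : q ∈ (extChartAt I p).source)
    (hf : ContMDiffAt I 𝓘(ℝ, ℝ) ∞ f q) : ContDiffAt ℝ ∞ (coordFun I f p) (extChartAt I p q) := by
  have hx := (extChartAt I p).map_source hq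
  have hl := (extChartAt I p).left_inv hq
  have h1 : ContMDiffAt 𝓘(ℝ, E) I ∞ (extChartAt I p).symm (extChartAt I p q) := by
    have := contMDiffWithinAt_extChartAt_symm_range (I := I) (n := ∞) p hx
    rwa [I.range_eq_univ, contMDiffWithinAt_univ] at this
  rw [← contMDiffAt_iff_contDiffAt]
  rw [← hl] at hf
  exact ContMDiffAt.comp (extChartAt I p q) hf h1

theorem fderiv_coordFun [I.Boundaryless] [IsManifold I ∞ M]
    {f : M → ℝ} (p q : M) (hq : q ∈ (extChartAt I p).source)
    (hf : MDifferentiableAt I 𝓘(ℝ, ℝ) f q) (v : E) :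
    fderiv ℝ (coordFun I f p) (extChartAt I p q) v
      = dFun I f q (symmDeriv I p (extChartAt I p q) v) := by
  have hx := (extChartAt I p).map_source hq
  have hl := (extChartAt I p).left_inv hq
  let D : M → E →L[ℝ] ℝ := fun q => mfderiv I 𝓘(ℝ, ℝ) f q
  have h1 : MDifferentiableAt I 𝓘(ℝ, ℝ) f ((extChartAt I p).symm (extChartAt I p q)) := by
    rwa [hl]
  have h2 := mfderiv_comp (extChartAt I p q) h1 (mdifferentiableAt_extChartAt_symm' p hx)
  rw [← mfderiv_eq_fderiv]
  change mfderiv 𝓘(ℝ, E) 𝓘(ℝ, ℝ) (f ∘ (extChartAt I p).symm) (extChartAt I p q) v = D q _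
  rw [h2]
  change D ((extChartAt I p).symm (extChartAt I p q)) _ = D q _
  rw [hl]
  rfl

theorem fderiv_coordFun_self [I.Boundaryless] [IsManifold I ∞ M]
    {f : M → ℝ} (p : M) (hf : MDifferentiableAt I 𝓘(ℝ, ℝ) f p) (v : E) :
    fderiv ℝ (coordFun I f p) (extChartAt I p p) v = dFun I f p v := by
  rw [fderiv_coordFun p p (mem_extChartAt_source p) hf, symmDeriv_self]
  rfl

theorem coordVec_apply [IsManifold I ∞ M] (p : M) (v : TangentSpace I p) : coordVec I p v = v := by
  rw [coordVec_eq]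
  rfl

theorem hessianAt_eq [IsManifold I ∞ M]
    (g : ∀ q : M, TangentSpace I q →L[ℝ] TangentSpace I q →L[ℝ] ℝ) (f : M → ℝ) (p : M)
    (v w : TangentSpace I p) : hessianAt I g f p v w
      = hessian (coordBilin I g p) (coordFun I f p) (extChartAt I p p) (v : E) (w : E) := by
  unfold hessianAt
  rw [coordVec_apply, coordVec_apply]

theorem extDerivOneForm_eq [IsManifold I ∞ M]
    (θ : ∀ q : M, TangentSpace I q →L[ℝ] ℝ) (p : M) (v w : TangentSpace I p) :
    extDerivOneForm I θ p v w = fderiv ℝ (coordForm I θ p) (extChartAt I p p) (v : E) (w : E)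
      - fderiv ℝ (coordForm I θ p) (extChartAt I p p) (w : E) (v : E) := by
  unfold extDerivOneForm
  rw [coordVec_apply, coordVec_apply]

theorem curvatureFormAt_eq [IsManifold I ∞ M]
    (g : ∀ q : M, TangentSpace I q →L[ℝ] TangentSpace I q →L[ℝ] ℝ) (p : M)
    (u v : TangentSpace I p) : curvatureFormAt I g p u v
      = coordBilin I g p (extChartAt I p p) (curvature (coordBilin I g p) (extChartAt I p p)
        (u : E) (v : E) (v : E)) (u : E) := by
  unfold curvatureFormAt
  rw [coordVec_apply, coordVec_apply]

/-- `hessianAt` uses a different chart at every point, whereas the Ricci identity needs the Hessian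
equation near a point in one chart. The transition map and `hessian_pullback` connect the two. -/
theorem hessian_coord_eq [I.Boundaryless] [IsManifold I ∞ M]
    {g : ∀ q : M, TangentSpace I q →L[ℝ] TangentSpace I q →L[ℝ] ℝ}
    {f : M → ℝ} (p q : M) (hq : q ∈ (extChartAt I p).source)
    (hgp : IsMetricAt (coordBilin I g p) (extChartAt I p q))
    (hgq : IsMetricAt (coordBilin I g q) (extChartAt I q q))
    (hf : ContMDiffAt I 𝓘(ℝ, ℝ) ∞ f q) (v w : E) :
    hessian (coordBilin I g p) (coordFun I f p) (extChartAt I p q) v w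
      = hessianAt I g f q (symmDeriv I p (extChartAt I p q) v)
        (symmDeriv I p (extChartAt I p q) w) := by
  have hx := (extChartAt I p).map_source hq
  have hl := (extChartAt I p).left_inv hq
  have hτ : chartChange I p q (extChartAt I p q) = extChartAt I q q := by
    rw [chartChange, hl]
  have h1 := (contDiffAt_chartChange p q hx (by rw [hl]; exact mem_extChartAt_source q)).of_le
    (m := 2) (by norm_cast)
  refine Eq.trans ?_ (hessianAt_eq g f q _ _).symm
  rw [← fderiv_chartChange p q hq, ← hτ]
  refine hessian_pullback (hτ ▸ hgq) hgp h1 ?_ ?_ (coordBilin_change g p q hq)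
    (coordFun_change f p q hq) v w
  · rw [fderiv_chartChange p q hq]
    exact symmDeriv_isInvertible p hx
  · rw [hτ]
    exact (contDiffAt_coordFun q q (mem_extChartAt_source q) hf).of_le (by norm_cast)

/-- The same passage to a fixed chart for `dθ`, whose equation is differentiated in
`SubmersionData.fderiv_ext`. -/
theorem fderiv_coordForm_eq [I.Boundaryless] [IsManifold I ∞ M]
    {θ : ∀ q : M, TangentSpace I q →L[ℝ] ℝ} (p q : M)
    (hq : q ∈ (extChartAt I p).source)
    (hθ : DifferentiableAt ℝ (coordForm I θ q) (extChartAt I q q)) (v w : E) :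
    fderiv ℝ (coordForm I θ p) (extChartAt I p q) v w
        - fderiv ℝ (coordForm I θ p) (extChartAt I p q) w v
      = extDerivOneForm I θ q (symmDeriv I p (extChartAt I p q) v)
        (symmDeriv I p (extChartAt I p q) w) := by
  have hx := (extChartAt I p).map_source hq
  have hl := (extChartAt I p).left_inv hq
  have hτ : chartChange I p q (extChartAt I p q) = extChartAt I q q := by
    rw [chartChange, hl]
  have h1 := (contDiffAt_chartChange p q hx (by rw [hl]; exact mem_extChartAt_source q)).of_le
    (m := 2) (by norm_cast)
  refine Eq.trans ?_ (extDerivOneForm_eq θ q _ _).symm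
  rw [← fderiv_chartChange p q hq, ← hτ]
  exact fderiv_pullback_form (hτ ▸ hθ) h1 (coordForm_change θ p q hq) v w

theorem contDiffAt_of_contMDiffAt_comp [I.Boundaryless] [IsManifold I ∞ M]
    {F : Type*} [NormedAddCommGroup F] [NormedSpace ℝ F] {f : M → F} {f' : E → F} {p : M}
    (hf : ContMDiffAt I 𝓘(ℝ, F) ∞ f p) (h : ∀ᶠ q in 𝓝 p, f q = f' (extChartAt I p q)) :
    ContDiffAt ℝ ∞ f' (extChartAt I p p) := by
  have h1 : ContMDiffAt 𝓘(ℝ, E) I ∞ (extChartAt I p).symm (extChartAt I p p) := by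
    have := contMDiffWithinAt_extChartAt_symm_range (I := I) (n := ∞) p (mem_extChartAt_target p)
    rwa [I.range_eq_univ, contMDiffWithinAt_univ] at this
  rw [← contMDiffAt_iff_contDiffAt]
  have hl := extChartAt_to_inv (I := I) p
  have hf' : ContMDiffAt I 𝓘(ℝ, F) ∞ f ((extChartAt I p).symm (extChartAt I p p)) := by rwa [hl]
  refine (ContMDiffAt.comp (extChartAt I p p) hf' h1).congr_of_eventuallyEq ?_
  have hc : Tendsto (extChartAt I p).symm (𝓝 (extChartAt I p p)) (𝓝 p) := by
    have := continuousAt_extChartAt_symm (I := I) p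
    rwa [ContinuousAt, hl] at this
  filter_upwards [hc.eventually h, extChartAt_target_mem_nhds (I := I) p] with y hy hy2
  rw [Function.comp_apply, hy, (extChartAt I p).right_inv hy2]

/-- Smoothness of a section is smoothness of its components in the bundle trivialization, and the
inverse of the tangent trivialization is the derivative of the inverse chart. -/
theorem contDiffAt_coordForm [I.Boundaryless] [IsManifold I ∞ M]
    {θ : ∀ q : M, TangentSpace I q →L[ℝ] ℝ} {S : Set M}
    (hθ : IsSmoothOneFormOn I θ S) {p : M} (hS : S ∈ 𝓝 p) :
    ContDiffAt ℝ ∞ (coordForm I θ p) (extChartAt I p p) := by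
  have : IsManifold I 1 M := IsManifold.of_le (n := ∞) (by simp)
  have h1 := ((contMDiffAt_hom_bundle _).1 ((hθ p (mem_of_mem_nhds hS)).contMDiffAt hS)).2
  refine contDiffAt_of_contMDiffAt_comp h1 ?_
  filter_upwards [extChartAt_source_mem_nhds (I := I) p] with q hq
  ext v
  rw [coordForm_eq θ p q hq]
  rw [extChartAt_source] at hq
  simp only [ContinuousLinearMap.inCoordinates, ContinuousLinearMap.comp_apply]
  rw [TangentBundle.symmL_trivializationAt hq, mfderivWithin_range_eq]
  simp
  rfl

theorem contDiffAt_coordBilin [I.Boundaryless] [IsManifold I ∞ M]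
    {g : ∀ q : M, TangentSpace I q →L[ℝ] TangentSpace I q →L[ℝ] ℝ}
    {p : M} (hg : ContMDiffAt I (I.prod 𝓘(ℝ, E →L[ℝ] E →L[ℝ] ℝ)) ∞
    (fun p => Bundle.TotalSpace.mk' (E →L[ℝ] E →L[ℝ] ℝ)
      (E := fun p : M => TangentSpace I p →L[ℝ] TangentSpace I p →L[ℝ]
        Bundle.Trivial M ℝ p) p (g p)) p) :
    ContDiffAt ℝ ∞ (coordBilin I g p) (extChartAt I p p) := by
  have : IsManifold I 1 M := IsManifold.of_le (n := ∞) (by simp)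
  have h1 := ((contMDiffAt_hom_bundle _).1 hg).2
  refine contDiffAt_of_contMDiffAt_comp h1 ?_
  filter_upwards [extChartAt_source_mem_nhds (I := I) p] with q hq
  ext v w
  rw [coordBilin_eq g p q hq]
  rw [extChartAt_source] at hq
  simp only [ContinuousLinearMap.inCoordinates, ContinuousLinearMap.comp_apply]
  rw [TangentBundle.symmL_trivializationAt hq, mfderivWithin_range_eq]
  rw [Bundle.Trivialization.continuousLinearMapAt_apply]
  rw [Bundle.Trivialization.coe_linearMapAt_of_mem]
  · simp only [hom_trivializationAt_apply]
    simp only [ContinuousLinearMap.inCoordinates, ContinuousLinearMap.comp_apply]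
    rw [TangentBundle.symmL_trivializationAt hq, mfderivWithin_range_eq]
    simp
    rfl
  · simpa [hom_trivializationAt_baseSet] using hq

end TensorsInCharts

/-! ### Functions with vanishing derivative -/

section Constancy

open Filter Topology CoordGeom

variable {E : Type*} [NormedAddCommGroup E] [NormedSpace ℝ E]
  {H : Type*} [TopologicalSpace H] {I : ModelWithCorners ℝ E H} [I.Boundaryless]
  {M : Type*} [TopologicalSpace M] [ChartedSpace H M] [IsManifold I ∞ M]

/-- The hypothesis sees each point only in its own chart. Transition maps spread the vanishing over
a whole chart, convex balls give local constancy, and connectedness does the rest. -/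
theorem exists_eq_const_of_hasFDerivAt_zero [ConnectedSpace M] {F : M → ℝ}
    (hF : ∀ p, HasFDerivAt (coordFun I F p) (0 : E →L[ℝ] ℝ) (extChartAt I p p)) :
    ∃ a, ∀ p, F p = a := by
  have hloc : IsLocallyConstant F := by
    rw [IsLocallyConstant.iff_eventually_eq]
    intro p
    have hall : ∀ x ∈ (extChartAt I p).target, HasFDerivAt (coordFun I F p) (0 : E →L[ℝ] ℝ) x := by
      intro x hx
      obtain ⟨q, hq, rfl⟩ : ∃ q ∈ (extChartAt I p).source, extChartAt I p q = x :=
        ⟨(extChartAt I p).symm x, (extChartAt I p).map_target hx, (extChartAt I p).right_inv hx⟩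
      have hl := (extChartAt I p).left_inv hq
      have h1 := (contDiffAt_chartChange p q hx
        (by rw [hl]; exact mem_extChartAt_source q)).differentiableAt (by simp)
      have hτ : chartChange I p q (extChartAt I p q) = extChartAt I q q := by
        rw [chartChange, hl]
      have h2 := (hτ ▸ hF q).comp (extChartAt I p q) h1.hasFDerivAt
      rw [ContinuousLinearMap.zero_comp] at h2
      exact h2.congr_of_eventuallyEq (coordFun_change F p q hq)
    obtain ⟨ε, hε, hball⟩ := Metric.mem_nhds_iff.1 (extChartAt_target_mem_nhds (I := I) p)
    have hnear : ∀ᶠ q in 𝓝 p, extChartAt I p q ∈ Metric.ball (extChartAt I p p) ε :=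
      (continuousAt_extChartAt (I := I) p).eventually (Metric.ball_mem_nhds _ hε)
    filter_upwards [hnear, extChartAt_source_mem_nhds (I := I) p] with q hq hqs
    have hconst := (convex_ball (extChartAt I p p) ε).is_const_of_fderivWithin_eq_zero
      (𝕜 := ℝ) (f := coordFun I F p)
      (fun y hy => (hall y (hball hy)).differentiableAt.differentiableWithinAt)
      (fun y hy => by
        rw [fderivWithin_of_isOpen Metric.isOpen_ball hy]
        exact (hall y (hball hy)).fderiv) hq (Metric.mem_ball_self hε)
    rwa [coordFun_eq F p q hqs, coordFun_eq F p p (mem_extChartAt_source p)] at hconst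
  obtain ⟨p⟩ : Nonempty M := inferInstance
  exact ⟨F p, fun q => hloc.apply_eq_of_isPreconnected isPreconnected_univ (Set.mem_univ _)
    (Set.mem_univ _)⟩

end Constancy

/-! ### The conformal metric `h/λ²` on the surface -/

section SurfaceInCharts

open Filter Topology CoordGeom

variable {N : Type*} [TopologicalSpace N] [ChartedSpace (EuclideanSpace ℝ (Fin 2)) N]

/-- The conformal metric `h / λ²`. -/
def baseMetric [IsManifold (𝓡 2) ∞ N]
    (h : SurfaceMetric N) (lam : N → ℝ) (q : N) :
    TangentSpace (𝓡 2) q →L[ℝ] TangentSpace (𝓡 2) q →L[ℝ] ℝ :=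
  let B : Plane →L[ℝ] Plane →L[ℝ] ℝ := h.inner q
  Real.exp (-2 * Real.log (lam q)) • B

/-- The logarithm of a positive function in the chart at `p`. -/
def coordLog (f : N → ℝ) (p : N) : Plane → ℝ := coordFun (𝓡 2) (fun q => Real.log (f q)) p

/-- Definitional because `baseMetric` has the factor `exp (-2 log λ)` instead of `1/λ²`. -/
theorem coordBilin_baseMetric [IsManifold (𝓡 2) ∞ N]
    (h : SurfaceMetric N) (lam : N → ℝ) (p : N) :
    coordBilin (𝓡 2) (baseMetric h lam) p
      = conformal (coordLog lam p) (coordBilin (𝓡 2) h.inner p) := rfl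

theorem isMetricAt_coordBilin [IsManifold (𝓡 2) ∞ N]
    (h : SurfaceMetric N) (p : N) :
    IsMetricAt (coordBilin (𝓡 2) h.inner p) (extChartAt (𝓡 2) p p) where
  contDiffAt := (contDiffAt_coordBilin (h.contMDiff p)).of_le (by norm_cast)
  symm := Eventually.of_forall fun _ _ _ => h.symm _ _ _
  inv := isInvertible_of_pos fun v hv => by
    rw [coordBilin_self]
    exact h.pos p v hv

theorem coordBilin_pos [IsManifold (𝓡 2) ∞ N]
    (h : SurfaceMetric N) (p : N) (v : Plane) (hv : v ≠ 0) :
    0 < coordBilin (𝓡 2) h.inner p (extChartAt (𝓡 2) p p) v v := by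
  rw [coordBilin_self]
  exact h.pos p v hv

theorem contMDiffAt_log {f : N → ℝ} (hf : ContMDiff (𝓡 2) 𝓘(ℝ, ℝ) ∞ f) (h0 : ∀ p, 0 < f p)
    (p : N) : ContMDiffAt (𝓡 2) 𝓘(ℝ, ℝ) ∞ (fun q => Real.log (f q)) p :=
  ContMDiffAt.comp p ((Real.contDiffAt_log.2 (h0 p).ne').contMDiffAt) (hf p)

theorem contDiffAt_coordLog [IsManifold (𝓡 2) ∞ N]
    {f : N → ℝ} (hf : ContMDiff (𝓡 2) 𝓘(ℝ, ℝ) ∞ f) (h0 : ∀ p, 0 < f p)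
    (p : N) : ContDiffAt ℝ ∞ (coordLog f p) (extChartAt (𝓡 2) p p) :=
  contDiffAt_coordFun p p (mem_extChartAt_source p) (contMDiffAt_log hf h0 p)

theorem coordLog_self (f : N → ℝ) (p : N) :
    coordLog f p (extChartAt (𝓡 2) p p) = Real.log (f p) :=
  coordFun_eq _ p p (mem_extChartAt_source p)

theorem gaussCurvature_eq [IsManifold (𝓡 2) ∞ N]
    (h : SurfaceMetric N) (p : N) :
    gaussCurvature h p = gauss (coordBilin (𝓡 2) h.inner p) (extChartAt (𝓡 2) p p) := by
  have h1 := fun u v : Plane => coordBilin_self h.inner p u v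
  have h2 := curvatureFormAt_eq h.inner p (stdVec 0 : Plane) (stdVec 1 : Plane)
  unfold gauss gram
  rw [← h2, h1, h1, h1]
  rfl

/-- The Gaussian curvature of the metric `h / λ²`. -/
def baseCurvature [IsManifold (𝓡 2) ∞ N]
    (h : SurfaceMetric N) (lam : N → ℝ) (p : N) : ℝ :=
  lam p ^ 2 * (gaussCurvature h p
    + laplacianAt (𝓡 2) h.inner (fun q => Real.log (lam q)) p)

theorem exp_two_mul_log {a : ℝ} (ha : 0 < a) : Real.exp (2 * Real.log a) = a ^ 2 := by
  rw [two_mul, Real.exp_add, Real.exp_log ha, sq]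

theorem exp_neg_two_mul_log {a : ℝ} (ha : 0 < a) : Real.exp (-2 * Real.log a) = 1 / a ^ 2 := by
  rw [neg_mul, Real.exp_neg, exp_two_mul_log ha, one_div]

theorem curvature_baseMetric [IsManifold (𝓡 2) ∞ N]
    (h : SurfaceMetric N) {lam : N → ℝ}
    (hl : ContMDiff (𝓡 2) 𝓘(ℝ, ℝ) ∞ lam) (hl0 : ∀ p, 0 < lam p) (p : N) (u v : Plane) :
    let k := coordBilin (𝓡 2) (baseMetric h lam) p
    let x := extChartAt (𝓡 2) p p
    k x (curvature k x u v v) u = baseCurvature h lam p * (k x u u * k x v v - k x u v ^ 2) := by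
  intro k x
  have h1 := apply_curvature_conformal_plane (isMetricAt_coordBilin h p) (coordBilin_pos h p)
    ((contDiffAt_coordLog hl hl0 p).of_le (by norm_cast)) u v
  rw [coordLog_self, exp_two_mul_log (hl0 p), ← gaussCurvature_eq] at h1
  exact h1

/-- This is `hessian_conformal_iff` with `S = K^N - 2ψ/λ²`: by `hS`, the factor `λ² (S + Δ log λ)`
is the curvature of `h/λ²` minus `2ψ`. -/
theorem hessian_baseMetric_iff [IsManifold (𝓡 2) ∞ N]
    (h : SurfaceMetric N) {lam ρ : N → ℝ}
    (hl : ContMDiff (𝓡 2) 𝓘(ℝ, ℝ) ∞ lam) (hl0 : ∀ p, 0 < lam p)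
    (hr : ContMDiff (𝓡 2) 𝓘(ℝ, ℝ) ∞ ρ) (hr0 : ∀ p, 0 < ρ p) (ψ : ℝ) (p : N) :
    (∀ v w : TangentSpace (𝓡 2) p, (gaussCurvature h p
            + laplacianAt (𝓡 2) h.inner (fun q => Real.log (lam q * (ρ q)⁻¹)) p
            + gradInnerAt (𝓡 2) h.inner (fun q => Real.log (ρ q)) (fun q => Real.log (ρ q)) p
            - gradInnerAt (𝓡 2) h.inner (fun q => Real.log (lam q)) (fun q => Real.log (ρ q)) p
            - 2 * ψ / lam p ^ 2) * h.inner p v w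
          + hessianAt (𝓡 2) h.inner (fun q => Real.log (ρ q)) p v w
          + 2 * symProd (𝓡 2) (dFun (𝓡 2) (fun q => Real.log (lam q)) p)
              (dFun (𝓡 2) (fun q => Real.log (ρ q)) p) v w
          - dFun (𝓡 2) (fun q => Real.log (ρ q)) p v
              * dFun (𝓡 2) (fun q => Real.log (ρ q)) p w = 0) ↔
      ∀ v w : TangentSpace (𝓡 2) p, hessianAt (𝓡 2) (baseMetric h lam) (fun q => Real.log (ρ q)) p v w
        = dFun (𝓡 2) (fun q => Real.log (ρ q)) p v * dFun (𝓡 2) (fun q => Real.log (ρ q)) p w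
          + (baseCurvature h lam p - 2 * ψ) * baseMetric h lam p v w := by
  have hL : laplacianAt (𝓡 2) h.inner (fun q => Real.log (lam q * (ρ q)⁻¹)) p
      = laplacian (coordBilin (𝓡 2) h.inner p) (fun y => coordLog lam p y - coordLog ρ p y)
        (extChartAt (𝓡 2) p p) := by
    have : (fun q => Real.log (lam q * (ρ q)⁻¹)) = fun q => Real.log (lam q) - Real.log (ρ q) := by
      funext q
      rw [Real.log_mul (hl0 q).ne' (inv_ne_zero (hr0 q).ne'), Real.log_inv]
      ring
    rw [this]
    rfl
  have hdl : ∀ v : TangentSpace (𝓡 2) p, dFun (𝓡 2) (fun q => Real.log (lam q)) p v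
      = fderiv ℝ (coordLog lam p) (extChartAt (𝓡 2) p p) v := fun v =>
    (fderiv_coordFun_self p ((contMDiffAt_log hl hl0 p).mdifferentiableAt (by simp)) v).symm
  have hdr : ∀ v : TangentSpace (𝓡 2) p, dFun (𝓡 2) (fun q => Real.log (ρ q)) p v
      = fderiv ℝ (coordLog ρ p) (extChartAt (𝓡 2) p p) v := fun v =>
    (fderiv_coordFun_self p ((contMDiffAt_log hr hr0 p).mdifferentiableAt (by simp)) v).symm
  have hin : ∀ v w : TangentSpace (𝓡 2) p, h.inner p v w
      = coordBilin (𝓡 2) h.inner p (extChartAt (𝓡 2) p p) v w := fun v w =>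
    (coordBilin_self h.inner p v w).symm
  have hbm : ∀ v w : TangentSpace (𝓡 2) p, baseMetric h lam p v w
      = conformal (coordLog lam p) (coordBilin (𝓡 2) h.inner p) (extChartAt (𝓡 2) p p) v w :=
    fun v w => (coordBilin_self (baseMetric h lam) p v w).symm
  have key := hessian_conformal_iff (isMetricAt_coordBilin h p) (coordBilin_pos h p)
    ((contDiffAt_coordLog hl hl0 p).of_le (by norm_cast))
    ((contDiffAt_coordLog hr hr0 p).of_le (by norm_cast)) (gaussCurvature h p - 2 * ψ / lam p ^ 2)
  rw [coordLog_self, exp_two_mul_log (hl0 p)] at key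
  have hS : lam p ^ 2 * (gaussCurvature h p - 2 * ψ / lam p ^ 2
      + laplacian (coordBilin (𝓡 2) h.inner p) (coordLog lam p) (extChartAt (𝓡 2) p p))
      = baseCurvature h lam p - 2 * ψ := by
    have hn : lam p ≠ 0 := (hl0 p).ne'
    change _ = lam p ^ 2 * (gaussCurvature h p
      + laplacian (coordBilin (𝓡 2) h.inner p) (coordLog lam p) (extChartAt (𝓡 2) p p)) - 2 * ψ
    field_simp
    ring
  rw [hS] at key
  have hgi : ∀ a b : N → ℝ, gradInnerAt (𝓡 2) h.inner (fun q => Real.log (a q))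
      (fun q => Real.log (b q)) p = gradInner (coordBilin (𝓡 2) h.inner p) (coordLog a p)
        (coordLog b p) (extChartAt (𝓡 2) p p) := fun _ _ => rfl
  have hρ : coordFun (𝓡 2) (fun q => Real.log (ρ q)) p = coordLog ρ p := rfl
  simp only [hL, hessianAt_eq, hdl, hdr, hin, hbm, symProd, hgi, hρ]
  refine Iff.trans (forall_congr' fun v => forall_congr' fun w => ?_) key
  rw [← eq_iff_iff]
  congr 1
  ring

end SurfaceInCharts

/-! ### The ansatz metric in charts -/

section Ansatz

open Filter Topology CoordGeom

theorem slab_mem_nhds {N : Type*} [TopologicalSpace N] {δ : ℝ} {q : N × ℝ}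
    (hq : q ∈ slab N δ) : slab N δ ∈ 𝓝 q :=
  (isOpen_Ioo.preimage continuous_snd).mem_nhds hq

variable {N : Type*} [TopologicalSpace N] [ChartedSpace (EuclideanSpace ℝ (Fin 2)) N]

theorem extChartAt_fst (q q' : N × ℝ) :
    (extChartAt I3 q q').1 = extChartAt (𝓡 2) q.1 q'.1 := by
  rw [extChartAt_prod]
  rfl

theorem extChartAt_symm_fst (q : N × ℝ) (z : Plane × ℝ) :
    ((extChartAt I3 q).symm z).1 = (extChartAt (𝓡 2) q.1).symm z.1 := by
  rw [extChartAt_prod]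
  rfl

theorem mem_source_I3 (q q' : N × ℝ) (hq : q' ∈ (extChartAt I3 q).source) :
    q'.1 ∈ (extChartAt (𝓡 2) q.1).source := by
  rw [extChartAt_prod] at hq
  exact hq.1

theorem dProj_eq (q : N × ℝ) (v : TangentSpace I3 q) : dProj q v = (v : Plane × ℝ).1 := by
  rw [dProj, mfderiv_fst]
  rfl

variable [IsManifold (𝓡 2) ∞ N]

/-- Charts of a product are products of charts, so in charts `φ` is the linear first projection. -/
theorem dProj_symmDeriv (q q' : N × ℝ) (hq : q' ∈ (extChartAt I3 q).source) (v : Plane × ℝ) :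
    dProj q' (symmDeriv I3 q (extChartAt I3 q q') v)
      = symmDeriv (𝓡 2) q.1 (extChartAt (𝓡 2) q.1 q'.1) v.1 := by
  have hz := (extChartAt I3 q).map_source hq
  have hl := (extChartAt I3 q).left_inv hq
  set z := extChartAt I3 q q' with hzdef
  have hz1 : z.1 = extChartAt (𝓡 2) q.1 q'.1 := extChartAt_fst q q'
  have ht : z.1 ∈ (extChartAt (𝓡 2) q.1).target :=
    hz1 ▸ (extChartAt (𝓡 2) q.1).map_source (mem_source_I3 q q' hq)
  have h1 := mfderiv_comp (I' := I3) (I'' := 𝓡 2) z (g := (Prod.fst : N × ℝ → N))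
    (mdifferentiableAt_fst (I := 𝓡 2) (I' := 𝓘(ℝ, ℝ)))
    (mdifferentiableAt_extChartAt_symm' q hz)
  have h2 : (Prod.fst : N × ℝ → N) ∘ (extChartAt I3 q).symm
      = (extChartAt (𝓡 2) q.1).symm ∘ (Prod.fst : Plane × ℝ → Plane) := by
    funext z
    exact extChartAt_symm_fst q z
  have h3 := mfderiv_comp (I := 𝓘(ℝ, Plane × ℝ)) (I' := 𝓘(ℝ, Plane)) (I'' := 𝓡 2) z
    (g := (extChartAt (𝓡 2) q.1).symm) (f := (Prod.fst : Plane × ℝ → Plane))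
    (mdifferentiableAt_extChartAt_symm' q.1 ht) differentiableAt_fst.mdifferentiableAt
  rw [h2, h3] at h1
  have h4 := congrArg (fun T : Plane × ℝ →L[ℝ] Plane => T v) h1
  rw [mfderiv_eq_fderiv, fderiv_fst] at h4
  rw [← hz1]
  refine Eq.trans ?_ h4.symm
  let D : N × ℝ → (Plane × ℝ →L[ℝ] Plane) := fun q => dProj q
  change D q' _ = D ((extChartAt I3 q).symm z) _
  rw [hl]
  rfl

theorem eventually_chart {E H M : Type*} [NormedAddCommGroup E] [NormedSpace ℝ E]
    [TopologicalSpace H] {I : ModelWithCorners ℝ E H} [I.Boundaryless] [TopologicalSpace M]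
    [ChartedSpace H M] {p : M} {P : E → Prop}
    (h : ∀ᶠ q in 𝓝 p, q ∈ (extChartAt I p).source → P (extChartAt I p q)) :
    ∀ᶠ x in 𝓝 (extChartAt I p p), P x := by
  rw [← map_extChartAt_nhds_of_boundaryless (I := I) p, eventually_map]
  filter_upwards [h, extChartAt_source_mem_nhds (I := I) p] with q h1 h2 using h1 h2

/-- Equality of germs is enough: by `curvature_congr` the curvature can be computed for the model
`submersionMetric`. -/
theorem coordBilin_ansatzMetric (h : SurfaceMetric N) {lam : N → ℝ} (hl0 : ∀ p, 0 < lam p)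
    (θ : ∀ q : N × ℝ, TangentSpace I3 q →L[ℝ] ℝ) (q : N × ℝ) :
    coordBilin I3 (ansatzMetric h lam θ) q =ᶠ[𝓝 (extChartAt I3 q q)]
      submersionMetric (coordBilin (𝓡 2) (baseMetric h lam) q.1) (coordForm I3 θ q) := by
  refine eventually_chart (Eventually.of_forall fun q' hq' => ?_)
  refine ContinuousLinearMap.ext fun v => ContinuousLinearMap.ext fun w => ?_
  have hq1 := mem_source_I3 q q' hq'
  have e0 := coordBilin_eq (ansatzMetric h lam θ) q q' hq' v w
  have e1 := ansatzMetric_apply h lam θ q' (symmDeriv I3 q (extChartAt I3 q q') v)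
    (symmDeriv I3 q (extChartAt I3 q q') w)
  rw [dProj_symmDeriv q q' hq', dProj_symmDeriv q q' hq'] at e1
  have e2 := coordBilin_eq (baseMetric h lam) q.1 q'.1 hq1 v.1 w.1
  rw [submersionMetric_apply, coordForm_eq θ q q' hq', coordForm_eq θ q q' hq', extChartAt_fst, e2]
  refine e0.trans (e1.trans ?_)
  rw [← exp_neg_two_mul_log (hl0 q'.1)]
  rfl

variable {h : SurfaceMetric N}
  {vol : ∀ p : N, TangentSpace (𝓡 2) p →L[ℝ] TangentSpace (𝓡 2) p →L[ℝ] ℝ}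
  {ψ lam ρ : N → ℝ} {δ : ℝ} {θ : ∀ q : N × ℝ, TangentSpace I3 q →L[ℝ] ℝ}

/-- The area form of `h / λ²` in the chart at `p`. -/
def coordArea (vol : ∀ p : N, TangentSpace (𝓡 2) p →L[ℝ] TangentSpace (𝓡 2) p →L[ℝ] ℝ)
    (lam : N → ℝ) (p : N) : Plane → Plane →L[ℝ] Plane →L[ℝ] ℝ :=
  conformal (coordLog lam p) (coordBilin (𝓡 2) vol p)

theorem coordArea_sq (hvol : IsVolumeForm h vol) (lam : N → ℝ) (p : N) (x v w : Plane) :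
    coordArea vol lam p x v w ^ 2 = coordBilin (𝓡 2) (baseMetric h lam) p x v v
        * coordBilin (𝓡 2) (baseMetric h lam) p x w w
      - coordBilin (𝓡 2) (baseMetric h lam) p x v w ^ 2 := by
  rw [coordBilin_baseMetric, coordArea]
  simp only [conformal_apply]
  have h1 : coordBilin (𝓡 2) vol p x v w ^ 2 = coordBilin (𝓡 2) h.inner p x v v
      * coordBilin (𝓡 2) h.inner p x w w - coordBilin (𝓡 2) h.inner p x v w ^ 2 := hvol.sq _ _ _
  rw [mul_pow, h1]
  ring

theorem differentiableAt_coordArea (hvol : IsVolumeForm h vol)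
    (hl : ContMDiff (𝓡 2) 𝓘(ℝ, ℝ) ∞ lam) (hl0 : ∀ p, 0 < lam p) (p : N) :
    DifferentiableAt ℝ (coordArea vol lam p) (extChartAt (𝓡 2) p p) :=
  (((contDiffAt_coordLog hl hl0 p).differentiableAt (by simp)).const_mul (-2)).exp.smul
    ((contDiffAt_coordBilin (hvol.smooth p)).differentiableAt (by simp))

theorem baseMetric_pos (h : SurfaceMetric N) (lam : N → ℝ) (p : N) (v : Plane) (hv : v ≠ 0) :
    0 < coordBilin (𝓡 2) (baseMetric h lam) p (extChartAt (𝓡 2) p p) v v :=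
  conformal_pos (l := coordLog lam p) (coordBilin_pos h p) v hv

theorem isMetricAt_baseMetric (h : SurfaceMetric N)
    (hl : ContMDiff (𝓡 2) 𝓘(ℝ, ℝ) ∞ lam) (hl0 : ∀ p, 0 < lam p) (p : N) :
    IsMetricAt (coordBilin (𝓡 2) (baseMetric h lam) p) (extChartAt (𝓡 2) p p) :=
  (isMetricAt_coordBilin h p).conformal ((contDiffAt_coordLog hl hl0 p).of_le (by norm_cast))

theorem IsAnsatzForm.contDiffAt_coordForm (hθ : IsAnsatzForm vol ψ lam ρ δ θ) {q : N × ℝ}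
    (hq : q ∈ slab N δ) : ContDiffAt ℝ ∞ (coordForm I3 θ q) (extChartAt I3 q q) :=
  _root_.contDiffAt_coordForm hθ.smooth (slab_mem_nhds hq)

theorem IsAnsatzForm.fderiv_coordForm (hθ : IsAnsatzForm vol ψ lam ρ δ θ)
    (hl0 : ∀ p, 0 < lam p) (hr : ContMDiff (𝓡 2) 𝓘(ℝ, ℝ) ∞ ρ) (hr0 : ∀ p, 0 < ρ p)
    {q : N × ℝ} (hq : q ∈ slab N δ) : ∀ᶠ z in 𝓝 (extChartAt I3 q q), ∀ v w,
      fderiv ℝ (coordForm I3 θ q) z v w - fderiv ℝ (coordForm I3 θ q) z w v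
        = fderiv ℝ (coordLog ρ q.1) z.1 w.1 * coordForm I3 θ q z v
          - fderiv ℝ (coordLog ρ q.1) z.1 v.1 * coordForm I3 θ q z w
          + coordFun (𝓡 2) (fun p => √(2 * ψ p)) q.1 z.1 * coordArea vol lam q.1 z.1 v.1 w.1 := by
  refine eventually_chart ?_
  filter_upwards [slab_mem_nhds hq] with q' hs hq' v w
  have hq1 := mem_source_I3 q q' hq'
  have e1 := fderiv_coordForm_eq (θ := θ) q q' hq'
    ((hθ.contDiffAt_coordForm hs).differentiableAt (by simp)) v w
  have e2 : extDerivOneForm I3 θ q' (symmDeriv I3 q (extChartAt I3 q q') v)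
        (symmDeriv I3 q (extChartAt I3 q q') w)
      + (dFun I3 (fun r : N × ℝ => Real.log (ρ r.1)) q' (symmDeriv I3 q (extChartAt I3 q q') v)
          * θ q' (symmDeriv I3 q (extChartAt I3 q q') w)
        - dFun I3 (fun r : N × ℝ => Real.log (ρ r.1)) q' (symmDeriv I3 q (extChartAt I3 q q') w)
          * θ q' (symmDeriv I3 q (extChartAt I3 q q') v))
      = √(2 * ψ q'.1) / lam q'.1 ^ 2 * vol q'.1
          (dProj q' (symmDeriv I3 q (extChartAt I3 q q') v))
          (dProj q' (symmDeriv I3 q (extChartAt I3 q q') w)) :=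
    hθ.ext q' hs (symmDeriv I3 q (extChartAt I3 q q') v) (symmDeriv I3 q (extChartAt I3 q q') w)
  have hd : ∀ v : Plane × ℝ, dFun I3 (fun r : N × ℝ => Real.log (ρ r.1)) q'
      (symmDeriv I3 q (extChartAt I3 q q') v)
      = fderiv ℝ (coordLog ρ q.1) (extChartAt (𝓡 2) q.1 q'.1) v.1 := by
    intro v
    have hm : MDifferentiableAt (𝓡 2) 𝓘(ℝ, ℝ) (fun p => Real.log (ρ p)) q'.1 :=
      (contMDiffAt_log hr hr0 q'.1).mdifferentiableAt (by simp)
    have c1 := mfderiv_comp (I := I3) (I' := 𝓡 2) (I'' := 𝓘(ℝ, ℝ)) q' hm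
      (mdifferentiableAt_fst (I := 𝓡 2) (I' := 𝓘(ℝ, ℝ)))
    have c2 := fderiv_coordFun q.1 q'.1 hq1 hm v.1
    rw [← dProj_symmDeriv q q' hq'] at c2
    refine Eq.trans ?_ c2.symm
    exact congrArg (fun T : Plane × ℝ →L[ℝ] ℝ => T (symmDeriv I3 q (extChartAt I3 q q') v)) c1
  rw [hd, hd, dProj_symmDeriv q q' hq', dProj_symmDeriv q q' hq'] at e2
  have e3 := coordBilin_eq vol q.1 q'.1 hq1 v.1 w.1
  have e4 := coordFun_eq (I := 𝓡 2) (fun p => √(2 * ψ p)) q.1 q'.1 hq1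
  have e5 : coordLog lam q.1 (extChartAt (𝓡 2) q.1 q'.1) = Real.log (lam q'.1) :=
    coordFun_eq _ _ _ hq1
  rw [e1, extChartAt_fst, coordForm_eq θ q q' hq', coordForm_eq θ q q' hq', coordArea,
    conformal_apply, e3, e4, e5, exp_neg_two_mul_log (hl0 q'.1)]
  linear_combination e2

/-- The square root may fail to be differentiable at zeros of `ψ`, but the structural equation
exhibits it as a quotient of differentiable functions, since the area form does not vanish on a
basis. -/
theorem IsAnsatzForm.differentiableAt_sqrt (hθ : IsAnsatzForm vol ψ lam ρ δ θ)
    (hvol : IsVolumeForm h vol)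
    (hl : ContMDiff (𝓡 2) 𝓘(ℝ, ℝ) ∞ lam) (hl0 : ∀ p, 0 < lam p)
    (hr : ContMDiff (𝓡 2) 𝓘(ℝ, ℝ) ∞ ρ) (hr0 : ∀ p, 0 < ρ p)
    {q : N × ℝ} (hq : q ∈ slab N δ) :
    DifferentiableAt ℝ (coordFun (𝓡 2) (fun p => √(2 * ψ p)) q.1) (extChartAt (𝓡 2) q.1 q.1) := by
  set x := extChartAt (𝓡 2) q.1 q.1 with hx
  have hQ : extChartAt I3 q q = (x, (extChartAt I3 q q).2) := Prod.ext (extChartAt_fst q q) rfl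
  set t := (extChartAt I3 q q).2
  -- The slice through `q` with constant fibre coordinate; `√(2ψ)` depends only on the base, so
  -- nothing is lost.
  let ι : Plane → Plane × ℝ := fun y => (y, t)
  have hι : DifferentiableAt ℝ ι x := differentiableAt_id.prodMk (differentiableAt_const _)
  have hιc : Tendsto ι (𝓝 x) (𝓝 (extChartAt I3 q q)) := by
    rw [hQ]
    exact hι.continuousAt
  have hμ := differentiableAt_coordArea hvol hl hl0 q.1
  have hn : coordArea vol lam q.1 x (stdVec 0) (stdVec 1) ≠ 0 :=
    area_ne_zero (isMetricAt_baseMetric h hl hl0 q.1).symm_self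
      (baseMetric_pos h lam q.1) fun v w => coordArea_sq hvol lam q.1 x v w
  have hμ1 : DifferentiableAt ℝ
      (fun y => coordArea vol lam q.1 y (stdVec 0) (stdVec 1)) x :=
    (hμ.clm_apply (differentiableAt_const _)).clm_apply (differentiableAt_const _)
  have hΘ := hθ.contDiffAt_coordForm hq
  rw [hQ] at hΘ
  have hΘ1 : DifferentiableAt ℝ (fun y => coordForm I3 θ q (ι y)) x :=
    DifferentiableAt.comp x (g := coordForm I3 θ q) (hΘ.differentiableAt (by simp)) hι
  have hΘ2 : DifferentiableAt ℝ (fun y => fderiv ℝ (coordForm I3 θ q) (ι y)) x :=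
    DifferentiableAt.comp x (g := fderiv ℝ (coordForm I3 θ q))
      ((hΘ.fderiv_right (m := 1) (by norm_cast)).differentiableAt (by simp)) hι
  have hρ : DifferentiableAt ℝ (fderiv ℝ (coordLog ρ q.1)) x :=
    ((contDiffAt_coordLog hr hr0 q.1).fderiv_right (m := 1) (by norm_cast)).differentiableAt
      (by simp)
  have hc : ∀ {F : Type} [NormedAddCommGroup F] [NormedSpace ℝ F] (c : F),
    DifferentiableAt ℝ (fun _ : Plane => c) x := fun c => differentiableAt_const c
  have hev := hιc.eventually (hθ.fderiv_coordForm hl0 hr hr0 hq)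
  -- The numerator is `(dΘ + dr ∧ Θ)(e₀, e₁)` along the slice.
  have hnum := (((hΘ2.clm_apply (hc ((stdVec 0, 0) : Plane × ℝ))).clm_apply
      (hc ((stdVec 1, 0) : Plane × ℝ))).fun_sub ((hΘ2.clm_apply
      (hc ((stdVec 1, 0) : Plane × ℝ))).clm_apply (hc ((stdVec 0, 0) : Plane × ℝ)))).fun_sub
    (((hρ.clm_apply (hc (stdVec 1))).fun_mul (hΘ1.clm_apply
      (hc ((stdVec 0, 0) : Plane × ℝ)))).fun_sub
      ((hρ.clm_apply (hc (stdVec 0))).fun_mul (hΘ1.clm_apply (hc ((stdVec 1, 0) : Plane × ℝ)))))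
  refine (hnum.fun_mul (hμ1.fun_inv hn)).congr_of_eventuallyEq ?_
  filter_upwards [hev, hμ1.continuousAt.eventually_ne hn] with y hy hne
  rw [← div_eq_mul_inv, eq_div_iff hne]
  have := hy (stdVec 0, 0) (stdVec 1, 0)
  simp only [ι] at this ⊢
  linarith

theorem IsAnsatzForm.submersionData (hθ : IsAnsatzForm vol ψ lam ρ δ θ)
    (hvol : IsVolumeForm h vol)
    (hl : ContMDiff (𝓡 2) 𝓘(ℝ, ℝ) ∞ lam) (hl0 : ∀ p, 0 < lam p)
    (hr : ContMDiff (𝓡 2) 𝓘(ℝ, ℝ) ∞ ρ) (hr0 : ∀ p, 0 < ρ p)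
    {q : N × ℝ} (hq : q ∈ slab N δ) :
    SubmersionData (coordBilin (𝓡 2) (baseMetric h lam) q.1) (coordArea vol lam q.1)
      (coordLog ρ q.1) (coordFun (𝓡 2) (fun p => √(2 * ψ p)) q.1) (coordForm I3 θ q)
      (extChartAt I3 q q) where
  metric := by
    rw [extChartAt_fst]
    exact isMetricAt_baseMetric h hl hl0 q.1
  form := (hθ.contDiffAt_coordForm hq).of_le (by norm_cast)
  form_ne := by
    rw [coordForm_self]
    refine hθ.ne_zero q hq ((0, 1) : Plane × ℝ) ?_ fun h0 => ?_
    · exact dProj_eq q _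
    · exact one_ne_zero (congrArg (fun v : Plane × ℝ => v.2) h0)
  fun_r := by
    rw [extChartAt_fst]
    exact (contDiffAt_coordLog hr hr0 q.1).of_le (by norm_cast)
  fun_s := by
    rw [extChartAt_fst]
    exact hθ.differentiableAt_sqrt hvol hl hl0 hr hr0 hq
  area := by
    rw [extChartAt_fst]
    exact differentiableAt_coordArea hvol hl hl0 q.1
  area_self := area_self_eq_zero fun v w => coordArea_sq hvol lam q.1 _ v w
  area_parallel := by
    rw [extChartAt_fst]
    exact area_parallel (isMetricAt_baseMetric h hl hl0 q.1)
      (baseMetric_pos h lam q.1) (differentiableAt_coordArea hvol hl hl0 q.1)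
      (Eventually.of_forall fun y v w => coordArea_sq hvol lam q.1 y v w)
  area_isometry := by
    rw [extChartAt_fst]
    exact area_isometry (isMetricAt_baseMetric h hl hl0 q.1).symm_self
      (baseMetric_pos h lam q.1) fun v w => coordArea_sq hvol lam q.1 _ v w
  ext := hθ.fderiv_coordForm hl0 hr hr0 hq

end Ansatz

/-! ### Constant curvature as equations on the surface -/

section ConstantCurvature

open Filter Topology CoordGeom

/-- As `ρ > 0`, a multiple `a ρ²` vanishes everywhere or nowhere according to `a`. In the second
case the two constants satisfy `a c = √2`. -/
theorem eq_zero_or_pos_iff_exists_sqrt_eq {N : Type*} {ψ ρ : N → ℝ} (hr0 : ∀ p, 0 < ρ p) (hψ : ∀ p, 0 ≤ ψ p) :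
    ((∀ p, ψ p = 0) ∨
        ((∀ p, 0 < ψ p) ∧ ∃ c : ℝ, ∀ p, ρ p ^ 2 * ψ p ^ (-(1 / 2) : ℝ) = c)) ↔
      ∃ a, ∀ p, √(2 * ψ p) = a * ρ p ^ 2 := by
  have hpow : ∀ p, ψ p ^ (-(1 / 2) : ℝ) = (√(ψ p))⁻¹ := fun p => by
    rw [Real.rpow_neg (hψ p), Real.sqrt_eq_rpow]
  simp only [hpow]
  constructor
  · rintro (h0 | ⟨h0, c, hc⟩)
    · exact ⟨0, fun p => by simp [h0]⟩
    · refine ⟨√2 * c⁻¹, fun p => ?_⟩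
      have h1 := Real.sqrt_pos.2 (h0 p)
      have h2 := hr0 p
      rw [← hc p, Real.sqrt_mul zero_le_two]
      field_simp
  · rintro ⟨a, ha⟩
    rcases eq_or_ne a 0 with rfl | h0
    · refine Or.inl fun p => ?_
      have := ha p
      rw [zero_mul, Real.sqrt_eq_zero (by linarith [hψ p])] at this
      linarith
    · have hpos : ∀ p, 0 < ψ p := fun p => by
        refine (hψ p).lt_of_ne fun h1 => ?_
        have h2 := ha p
        rw [← h1, mul_zero, Real.sqrt_zero] at h2
        exact mul_ne_zero h0 (pow_ne_zero 2 (hr0 p).ne') h2.symm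
      refine Or.inr ⟨hpos, √2 * a⁻¹, fun p => ?_⟩
      have h1 := Real.sqrt_pos.2 (hpos p)
      have h2 := ha p
      rw [Real.sqrt_mul zero_le_two] at h2
      field_simp
      linarith

variable {N : Type*} [TopologicalSpace N] [ChartedSpace (EuclideanSpace ℝ (Fin 2)) N]
  [IsManifold (𝓡 2) ∞ N] {h : SurfaceMetric N}
  {vol : ∀ p : N, TangentSpace (𝓡 2) p →L[ℝ] TangentSpace (𝓡 2) p →L[ℝ] ℝ}
  {ψ lam ρ : N → ℝ} {δ : ℝ} {θ : ∀ q : N × ℝ, TangentSpace I3 q →L[ℝ] ℝ}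

theorem IsAnsatzForm.constant_curvature_iff (hθ : IsAnsatzForm vol ψ lam ρ δ θ)
    (hvol : IsVolumeForm h vol)
    (hl : ContMDiff (𝓡 2) 𝓘(ℝ, ℝ) ∞ lam) (hl0 : ∀ p, 0 < lam p)
    (hr : ContMDiff (𝓡 2) 𝓘(ℝ, ℝ) ∞ ρ) (hr0 : ∀ p, 0 < ρ p) (hψ : ∀ p, 0 ≤ ψ p)
    {q : N × ℝ} (hq : q ∈ slab N δ) (c : ℝ) :
    (∀ u v : TangentSpace I3 q, curvatureFormAt I3 (ansatzMetric h lam θ) q u v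
        = c * (ansatzMetric h lam θ q u u * ansatzMetric h lam θ q v v
          - ansatzMetric h lam θ q u v ^ 2)) ↔
      baseCurvature h lam q.1 - 3 / 2 * ψ q.1 = c ∧
      (∀ v w : TangentSpace (𝓡 2) q.1,
        hessianAt (𝓡 2) (baseMetric h lam) (fun p => Real.log (ρ p)) q.1 v w
          = dFun (𝓡 2) (fun p => Real.log (ρ p)) q.1 v * dFun (𝓡 2) (fun p => Real.log (ρ p)) q.1 w
            + (baseCurvature h lam q.1 - 2 * ψ q.1) * baseMetric h lam q.1 v w) ∧
      ∀ u, fderiv ℝ (coordFun (𝓡 2) (fun p => √(2 * ψ p)) q.1) (extChartAt (𝓡 2) q.1 q.1) u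
        = 2 * √(2 * ψ q.1) * fderiv ℝ (coordLog ρ q.1) (extChartAt (𝓡 2) q.1 q.1) u := by
  have key := (hθ.submersionData hvol hl hl0 hr hr0 hq).constant_curvature_iff
    (by rw [extChartAt_fst]; exact baseMetric_pos h lam q.1)
    (fun v w => coordArea_sq hvol lam q.1 _ v w)
    (by rw [extChartAt_fst]; exact curvature_baseMetric h hl hl0 q.1) c
  rw [extChartAt_fst, coordFun_eq _ _ _ (mem_extChartAt_source q.1),
    Real.sq_sqrt (by linarith [hψ q.1])] at key
  have hm := coordBilin_ansatzMetric h hl0 θ q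
  have h0 := hm.self_of_nhds
  have hg : ∀ u v : TangentSpace I3 q, ansatzMetric h lam θ q u v
      = submersionMetric (coordBilin (𝓡 2) (baseMetric h lam) q.1) (coordForm I3 θ q)
        (extChartAt I3 q q) u v := fun u v =>
    (coordBilin_self (ansatzMetric h lam θ) q u v).symm.trans (by rw [h0])
  refine Iff.trans (forall_congr' fun u => forall_congr' fun v => ?_) (key.trans ?_)
  · have hc := curvature_congr hm (u : Plane × ℝ) (v : Plane × ℝ) (v : Plane × ℝ)
    rw [hg, hg, hg, curvatureFormAt_eq, h0, hc]
  · have hdr : ∀ v : TangentSpace (𝓡 2) q.1, dFun (𝓡 2) (fun p => Real.log (ρ p)) q.1 v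
        = fderiv ℝ (coordLog ρ q.1) (extChartAt (𝓡 2) q.1 q.1) v := fun v =>
      (fderiv_coordFun_self q.1 ((contMDiffAt_log hr hr0 q.1).mdifferentiableAt (by simp)) v).symm
    have hb : ∀ v w : TangentSpace (𝓡 2) q.1, baseMetric h lam q.1 v w
        = coordBilin (𝓡 2) (baseMetric h lam) q.1 (extChartAt (𝓡 2) q.1 q.1) v w := fun v w =>
      (coordBilin_self (baseMetric h lam) q.1 v w).symm
    simp only [hessianAt_eq, hdr, hb]
    rw [show baseCurvature h lam q.1 - 3 / 4 * (2 * ψ q.1)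
      = baseCurvature h lam q.1 - 3 / 2 * ψ q.1 by ring]
    -- The first equation eliminates `c`: the coefficient `c - ψ/2` of the metric becomes `K - 2ψ`.
    refine and_congr_right fun hc => ?_
    rw [← hc, show baseCurvature h lam q.1 - 3 / 2 * ψ q.1 - 1 / 4 * (2 * ψ q.1)
      = baseCurvature h lam q.1 - 2 * ψ q.1 by ring]
    rfl

/-- A function `s` with `ds = 2 s d log ρ` is a constant multiple of `ρ²`. -/
theorem exists_eq_mul_sq [ConnectedSpace N] {s : N → ℝ}
    (hr : ContMDiff (𝓡 2) 𝓘(ℝ, ℝ) ∞ ρ) (hr0 : ∀ p, 0 < ρ p)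
    (hs : ∀ p, HasFDerivAt (coordFun (𝓡 2) s p)
      ((2 * s p) • fderiv ℝ (coordLog ρ p) (extChartAt (𝓡 2) p p)) (extChartAt (𝓡 2) p p)) :
    ∃ a, ∀ p, s p = a * ρ p ^ 2 := by
  -- The function `s ρ⁻²` has zero differential.
  obtain ⟨a, ha⟩ := exists_eq_const_of_hasFDerivAt_zero (I := 𝓡 2)
    (F := fun p => s p * Real.exp (-2 * Real.log (ρ p))) fun p => by
    have h1 := ((contDiffAt_coordLog hr hr0 p).differentiableAt (by simp)).hasFDerivAt
    have h2 := (hs p).fun_mul (h1.const_mul (-2)).exp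
    rw [coordLog_self, coordFun_eq _ _ _ (mem_extChartAt_source p)] at h2
    refine h2.congr_fderiv ?_
    ext v
    simp
    ring
  refine ⟨a, fun p => ?_⟩
  have h1 := hr0 p
  rw [← ha p, exp_neg_two_mul_log h1]
  field_simp

/-- The function `K - 2ψ` of a solution of the Hessian equation has derivative `-2ψ d log ρ`. -/
theorem hasFDerivAt_baseCurvature_sub
    (hl : ContMDiff (𝓡 2) 𝓘(ℝ, ℝ) ∞ lam) (hl0 : ∀ p, 0 < lam p)
    (hr : ContMDiff (𝓡 2) 𝓘(ℝ, ℝ) ∞ ρ) (hr0 : ∀ p, 0 < ρ p)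
    (hess : ∀ (p : N) (v w : TangentSpace (𝓡 2) p),
      hessianAt (𝓡 2) (baseMetric h lam) (fun p => Real.log (ρ p)) p v w
        = dFun (𝓡 2) (fun p => Real.log (ρ p)) p v * dFun (𝓡 2) (fun p => Real.log (ρ p)) p w
          + (baseCurvature h lam p - 2 * ψ p) * baseMetric h lam p v w) (p : N) :
    HasFDerivAt (coordFun (𝓡 2) (fun p => baseCurvature h lam p - 2 * ψ p) p)
      (-(2 * ψ p) • fderiv ℝ (coordLog ρ p) (extChartAt (𝓡 2) p p)) (extChartAt (𝓡 2) p p) := by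
  have hev : ∀ᶠ q in 𝓝 p,
      IsMetricAt (coordBilin (𝓡 2) (baseMetric h lam) p) (extChartAt (𝓡 2) p q) :=
    (continuousAt_extChartAt (I := 𝓡 2) p).eventually (isMetricAt_baseMetric h hl hl0 p).eventually
  -- Here `κ = K - 2ψ`, so the factor `K - κ` is `2ψ`.
  have key := fderiv_of_hessian_eq (isMetricAt_baseMetric h hl hl0 p) (baseMetric_pos h lam p)
    ((contDiffAt_coordLog hr hr0 p).of_le (by norm_cast))
    (κ := coordFun (𝓡 2) (fun p => baseCurvature h lam p - 2 * ψ p) p) (eventually_chart ?_)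
    (curvature_baseMetric h hl hl0 p)
  · rw [coordFun_eq _ _ _ (mem_extChartAt_source p)] at key
    convert key using 2
    ring
  · filter_upwards [hev] with q hm hq v w
    have hlog := contMDiffAt_log hr hr0 q
    have e1 := hessian_coord_eq p q hq hm (isMetricAt_baseMetric h hl hl0 q) hlog v w
    have e2 := fderiv_coordFun p q hq (hlog.mdifferentiableAt (by simp)) v
    have e3 := fderiv_coordFun p q hq (hlog.mdifferentiableAt (by simp)) w
    have e4 := coordBilin_eq (baseMetric h lam) p q hq v w
    have e5 := coordFun_eq (I := 𝓡 2) (fun p => baseCurvature h lam p - 2 * ψ p) p q hq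
    unfold coordLog
    rw [e1, e2, e3, e4, e5]
    exact hess q _ _

/-- Under the Hessian equation, `K - 3/2 ψ` is constant if `√(2ψ)` is a multiple of `ρ²`. -/
theorem exists_baseCurvature_sub_eq [ConnectedSpace N]
    (hl : ContMDiff (𝓡 2) 𝓘(ℝ, ℝ) ∞ lam) (hl0 : ∀ p, 0 < lam p)
    (hr : ContMDiff (𝓡 2) 𝓘(ℝ, ℝ) ∞ ρ) (hr0 : ∀ p, 0 < ρ p) (hψ : ∀ p, 0 ≤ ψ p)
    {a : ℝ} (ha : ∀ p, √(2 * ψ p) = a * ρ p ^ 2)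
    (hess : ∀ (p : N) (v w : TangentSpace (𝓡 2) p),
      hessianAt (𝓡 2) (baseMetric h lam) (fun p => Real.log (ρ p)) p v w
        = dFun (𝓡 2) (fun p => Real.log (ρ p)) p v * dFun (𝓡 2) (fun p => Real.log (ρ p)) p w
          + (baseCurvature h lam p - 2 * ψ p) * baseMetric h lam p v w) :
    ∃ c, ∀ p, baseCurvature h lam p - 3 / 2 * ψ p = c := by
  have hψρ : ∀ p, ψ p = 1 / 2 * (a * Real.exp (2 * Real.log (ρ p))) ^ 2 := fun p => by
    rw [exp_two_mul_log (hr0 p), ← ha p, Real.sq_sqrt (by linarith [hψ p])]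
    ring
  refine exists_eq_const_of_hasFDerivAt_zero (I := 𝓡 2) fun p => ?_
  have h1 := ((contDiffAt_coordLog hr hr0 p).differentiableAt (by simp)).hasFDerivAt
  have hE := ((h1.const_mul 2).exp).const_mul a
  -- The added function is `(a ρ²)² / 4 = ψ/2`, with derivative `2ψ d log ρ`; this cancels the
  -- derivative of `K - 2ψ`.
  have h2 := (hasFDerivAt_baseCurvature_sub hl hl0 hr hr0 hess p).fun_add
    ((hE.fun_mul hE).const_mul (1 / 4))
  rw [coordLog_self] at h2
  refine (h2.congr_of_eventuallyEq (Eventually.of_forall fun y => ?_)).congr_fderiv ?_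
  · have h3 := hψρ ((extChartAt (𝓡 2) p).symm y)
    simp only [coordFun, coordLog]
    linarith
  · ext v
    have h3 := hψρ p
    simp [h3]
    ring

theorem hasFDerivAt_of_eq_mul_sq (hr : ContMDiff (𝓡 2) 𝓘(ℝ, ℝ) ∞ ρ) (hr0 : ∀ p, 0 < ρ p)
    {s : N → ℝ} {a : ℝ} (ha : ∀ p, s p = a * ρ p ^ 2) (p : N) :
    HasFDerivAt (coordFun (𝓡 2) s p)
      ((2 * s p) • fderiv ℝ (coordLog ρ p) (extChartAt (𝓡 2) p p)) (extChartAt (𝓡 2) p p) := by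
  have h1 := ((contDiffAt_coordLog hr hr0 p).differentiableAt (by simp)).hasFDerivAt
  have h2 := (h1.const_mul 2).exp.const_mul a
  rw [coordLog_self, exp_two_mul_log (hr0 p)] at h2
  refine (h2.congr_of_eventuallyEq (Eventually.of_forall fun y => ?_)).congr_fderiv ?_
  · have h3 := ha ((extChartAt (𝓡 2) p).symm y)
    rw [← exp_two_mul_log (hr0 _)] at h3
    exact h3
  · ext v
    simp [ha p]
    ring

end ConstantCurvature

end

theorem mainTheorem8 {N : Type*} [TopologicalSpace N] [ConnectedSpace N]
    [ChartedSpace (EuclideanSpace ℝ (Fin 2)) N] [IsManifold (𝓡 2) ∞ N]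
    (h : SurfaceMetric N)
    (vol : ∀ p : N, TangentSpace (𝓡 2) p →L[ℝ] TangentSpace (𝓡 2) p →L[ℝ] ℝ)
    (hvol : IsVolumeForm h vol)
    (ψ lam ρ ν : N → ℝ) (A : ℝ) (hsys : SolitonSystem h ψ lam ρ ν A)
    (δ : ℝ) (hδ : 0 < δ)
    (θ : ∀ q : N × ℝ, TangentSpace I3 q →L[ℝ] ℝ) (hθ : IsAnsatzForm vol ψ lam ρ δ θ) :
    HasConstantCurvatureOn I3 (ansatzMetric h lam θ) (slab N δ) ↔
      ((∀ p, ψ p = 0) ∨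
        ((∀ p, 0 < ψ p) ∧ ∃ c : ℝ, ∀ p, ρ p ^ 2 * ψ p ^ (-(1 / 2) : ℝ) = c)) ∧
      ∀ (p : N) (v w : TangentSpace (𝓡 2) p),
        (gaussCurvature h p
            + laplacianAt (𝓡 2) h.inner (fun q => Real.log (lam q * (ρ q)⁻¹)) p
            + gradInnerAt (𝓡 2) h.inner (fun q => Real.log (ρ q)) (fun q => Real.log (ρ q)) p
            - gradInnerAt (𝓡 2) h.inner (fun q => Real.log (lam q)) (fun q => Real.log (ρ q)) p
            - 2 * ψ p / lam p ^ 2) * h.inner p v w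
          + hessianAt (𝓡 2) h.inner (fun q => Real.log (ρ q)) p v w
          + 2 * symProd (𝓡 2) (dFun (𝓡 2) (fun q => Real.log (lam q)) p)
              (dFun (𝓡 2) (fun q => Real.log (ρ q)) p) v w
          - dFun (𝓡 2) (fun q => Real.log (ρ q)) p v
              * dFun (𝓡 2) (fun q => Real.log (ρ q)) p w = 0 := by
  have hl := hsys.smooth_lam
  have hl0 := hsys.lam_pos
  have hr := hsys.smooth_rho
  have hr0 := hsys.rho_pos
  have hψ := hsys.psi_nonneg
  -- The three equations live on `N`, so one point of `M` over each `p` is enough to derive them.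
  have hslab : ∀ p : N, ((p, 0) : N × ℝ) ∈ slab N δ := fun p => ⟨neg_lt_zero.2 hδ, hδ⟩
  rw [eq_zero_or_pos_iff_exists_sqrt_eq hr0 hψ,
    forall_congr' fun p => hessian_baseMetric_iff h hl hl0 hr hr0 (ψ p) p]
  constructor
  · rintro ⟨c, hc⟩
    have key := fun p => (hθ.constant_curvature_iff hvol hl hl0 hr hr0 hψ (hslab p) c).1
      (hc _ (hslab p))
    refine ⟨exists_eq_mul_sq hr hr0 fun p => ?_, fun p => (key p).2.1⟩
    have hd := hθ.differentiableAt_sqrt hvol hl hl0 hr hr0 (hslab p)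
    exact hd.hasFDerivAt.congr_fderiv (ContinuousLinearMap.ext (key p).2.2)
  · rintro ⟨⟨a, ha⟩, hess⟩
    -- The pointwise equations determine `c` as `K - 3/2 ψ`; the Ricci identity makes it the same
    -- constant everywhere.
    obtain ⟨c, hc⟩ := exists_baseCurvature_sub_eq hl hl0 hr hr0 hψ ha hess
    refine ⟨c, fun q hq => (hθ.constant_curvature_iff hvol hl hl0 hr hr0 hψ hq c).2
      ⟨hc q.1, hess q.1, fun u => ?_⟩⟩
    rw [(hasFDerivAt_of_eq_mul_sq hr hr0 ha q.1).fderiv]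
    rfl
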